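/- \textbf{Theorem (Existence of Solution to Hamiltonian ODE).} Let $D=2d$ and write points of phase space $\mathbb R^D$ as $x=(p,q)$ with $p,q\in\mathbb R^d$; let $J(p,q)=(-q,p)$. Let $W\in C_c^2(\mathbb R^d)$ be even and $\Phi\in C^2(\mathbb R^d)$. For a finite Borel measure $\mu$ on $\mathbb R^D$ put $(W*\mu)(q)=\int W(q-q')\,d\mu(p',q')$ and $$\nabla_W\mathscr H(\mu)(p,q)=\bigl(p,\ \nabla(W*\mu+\Phi)(q)\bigr),$$ the Wasserstein gradient of $\mathscr H(\mu)=\frac12\int|p|^2d\mu+\frac12\int (W*\mu)(q)\,d\mu+\int\Phi(q)\,d\mu$. \emph{Dynamical hypothesis.} There are $B\in\mathbb R$ with $|\nabla W(q)|<B$ for all $q$, a function $u\in C^2(\mathbb R)$ with $$u'(r)\ \ge\ B+\max_{|q|=r}\Bigl\langle\nabla\Phi(q),\tfrac{q}{|q|}\Bigr\rangle\qquad(r>0),$$ and points $q^\star_L\in\mathbb R^d$ ($L\in\mathbb N$) with $|q^\star_L|$ nondecreasing and tending to $\infty$, such that $u(|q|)<u(|q_L^\star|)$ whenever $|q|>|q^\star_L|$.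 \emph{Time-discretized deficient solutions.} Let $0<T<\infty$, $\alpha_0>0$, and let $\mu_0$ be a Borel measure on $\mathbb R^D$ of total mass $1$ with $\int e^{\alpha_0|x|}\,d\mu_0<\infty$. For a locally Lipschitz vector field $v$ on $\mathbb R^D$, $\varepsilon>0$, $s\ge0$ and a finite measure $\mu$, let $X_s(x)$ be the flow of $\dot X=v(X)$, $X_0=x$, let $\mathbb S_s$ be the set of $x$ whose trajectory exists on $[0,s]$, and let $\mathcal E^{\varepsilon,v}_s\mu$ be the measure given by $$\int\psi\,d(\mathcal E^{\varepsilon,v}_s\mu)=\int_{\mathbb S_s}\psi(X_s(x))\exp\Bigl(-\int_0^s\varepsilon|\dot X_r(x)|\,dr\Bigr)d\mu(x)$$ (it solves $\partial_s\mu_s+\nabla\cdot(v\mu_s)=-\varepsilon|v|\mu_s$). For $n\ge1$ and $h=T/n$ define $\mu^{\varepsilon,n}_0=\mu_0$ and, inductively in $k$, $\mu_t^{\varepsilon,n}=\mathcal E^{\varepsilon,v_k}_{t-kh}\,\mu^{\varepsilon,n}_{kh}$ for $t\in[kh,(k+1)h]$, with the frozen velocity field $v_k=J\nabla_W\mathscr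 H(\mu_{kh}^{\varepsilon,n})$. \emph{Conclusion.} Under the dynamical hypothesis there are a sequence $\varepsilon_k>0$ strictly decreasing to $0$, a strictly increasing sequence of integers $n_k\ge1$, and Borel measures $(\mu_t)_{t\in[0,T]}$ on $\mathbb R^D$ starting at $\mu_0$ such that, for every $t\in[0,T]$ and $\varphi\in C_c^\infty(\mathbb R^D)$, $\int\varphi\,d\mu_t^{\varepsilon_k,n_k}\to\int\varphi\,d\mu_t$, and: (i) for every $\varphi\in C_c^\infty(\mathbb R^D)$ the function $t\mapsto\int\varphi\,d\mu_t$ is continuous on $[0,T]$, and $\mu_t(\mathbb R^D)\le1$ for all $t\in[0,T]$; (ii) $(\mu_t)$ satisfies the Hamiltonian ODE $\partial_t\mu_t+\nabla\cdot(J\nabla_W\mathscr H(\mu_t)\mu_t)=0$ in the sense of distributions: for every $\varphi\in C_c^\infty((0,T)\times\mathbb R^D)$ the following integrals exist and $$\int_0^T\int_{\mathbb R^D}\bigl(\partial_t\varphi+\langle J\nabla_W\mathscr H(\mu_t),\nabla\varphi\rangle\bigr)\,d\mu_t\,dt=0.$$ -/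

import Mathlib

open MeasureTheory Set Filter Topology
open scoped ContDiff ENNReal

/-- Position (or momentum) space `ℝ^d` with its Euclidean norm. -/
abbrev Space (d : ℕ) : Type := EuclideanSpace ℝ (Fin d)

/-- Phase space `ℝ^D`, `D = 2d`, with its Euclidean norm; a point is `x = (p, q)`, that is,
`x.fst` is the momentum and `x.snd` is the position. -/
abbrev Phase (d : ℕ) : Type := WithLp 2 (Space d × Space d)

/-- The symplectic matrix `J (p, q) = (-q, p)`. -/
def symplJ {d : ℕ} (x : Phase d) : Phase d :=
  WithLp.toLp 2 (-x.snd, x.fst)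

/-- `(W * μ)(q) = ∫ W (q - q') dμ(p', q')`. -/
noncomputable def convPotential {d : ℕ} (W : Space d → ℝ) (μ : Measure (Phase d))
    (q : Space d) : ℝ :=
  ∫ y, W (q - y.snd) ∂μ

/-- The Wasserstein gradient of the Hamiltonian
`ℋ(μ) = ½ ∫ |p|² dμ + ½ ∫ (W * μ)(q) dμ + ∫ Φ(q) dμ`, as a vector field on phase space:
`∇_W ℋ(μ) (p, q) = (p, ∇(W * μ + Φ)(q))`. -/
noncomputable def gradHam {d : ℕ} (W Φ : Space d → ℝ) (μ : Measure (Phase d))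
    (x : Phase d) : Phase d :=
  WithLp.toLp 2 (x.fst, gradient (fun q => convPotential W μ q + Φ q) x.snd)

/-- The velocity field `J ∇_W ℋ(μ)`. -/
noncomputable def hamVelocity {d : ℕ} (W Φ : Space d → ℝ) (μ : Measure (Phase d))
    (x : Phase d) : Phase d :=
  symplJ (gradHam W Φ μ x)

/-- The set `𝕊_s` of the initial points `x` for which the solution of `Ẋ = v(X)`, `X_0 = x`, exists
on the whole of `[0, s]`, i.e. whose maximal existence time is larger than `s`. -/
def survivors {d : ℕ} (v : Phase d → Phase d) (s : ℝ) : Set (Phase d) :=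
  {x | ∃ γ : ℝ → Phase d, γ 0 = x ∧ IsIntegralCurveOn γ (fun _ => v) (Icc 0 s)}

open Classical in
/-- The flow `X_s(x)` of `Ẋ = v(X)`, `X_0 = x`, at a time `s` at which it exists
(and `x` otherwise; that value is never used). -/
noncomputable def flow {d : ℕ} (v : Phase d → Phase d) (s : ℝ) (x : Phase d) : Phase d :=
  if h : x ∈ survivors v s then h.choose s else x

/-- The solution at time `s`, with initial measure `μ`, of the deficient continuity equation
`∂ₛ μ_s + ∇·(v μ_s) = -ε |v| μ_s` with the time-independent velocity field `v`: the measure with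
`∫ ψ dμ_s = ∫_{𝕊_s} (R_s ψ) ∘ X_s dμ`, where `R_s ∘ X_s = exp (-ε ∫₀ˢ |Ẋ_r| dr)`. -/
noncomputable def deficientEvolution {d : ℕ} (ε : ℝ) (v : Phase d → Phase d) (s : ℝ)
    (μ : Measure (Phase d)) : Measure (Phase d) :=
  ((μ.restrict (survivors v s)).withDensity
    (fun x => ENNReal.ofReal (Real.exp (-(∫ r in (0 : ℝ)..s, ε * ‖v (flow v r x)‖))))).map
    (flow v s)

/-- The time-discretized measure at the grid point `k h`: it starts at `μ₀`, and from `k h` to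
`(k + 1) h` it solves the deficient continuity equation with the frozen velocity field
`J ∇_W ℋ` of the measure at `k h`. -/
noncomputable def gridMeasure {d : ℕ} (W Φ : Space d → ℝ) (μ₀ : Measure (Phase d)) (ε h : ℝ) :
    ℕ → Measure (Phase d)
  | 0 => μ₀
  | k + 1 => deficientEvolution ε (hamVelocity W Φ (gridMeasure W Φ μ₀ ε h k)) h
      (gridMeasure W Φ μ₀ ε h k)

/-- The time-discretized deficient solution `μ_t^{ε,n}` on `[0, T]`, with step `h = T / n`: for
`t ∈ [k h, (k + 1) h)` it is the evolution for the time `t - k h` of the measure at `k h` along the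
frozen velocity field `J ∇_W ℋ` of that measure. -/
noncomputable def discretized {d : ℕ} (W Φ : Space d → ℝ) (μ₀ : Measure (Phase d)) (T ε : ℝ)
    (n : ℕ) (t : ℝ) : Measure (Phase d) :=
  let h : ℝ := T / n
  let k : ℕ := ⌊t / h⌋₊
  let ν : Measure (Phase d) := gridMeasure W Φ μ₀ ε h k
  deficientEvolution ε (hamVelocity W Φ ν) (t - k * h) ν

/-- The dynamical hypothesis: there is a radial bounding potential `Υ(q) = u(|q|)`, with
`u' (r) ≥ B + max_{|q| = r} ⟨∇Φ(q), q/|q|⟩` for a strict bound `B` of `|∇W|` (and hence of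
`|∇(W * μ)|` for every `μ` of mass at most one), and points `q*_L` with `|q*_L| ↑ ∞` such that
`Υ(q) < Υ(q*_L)` whenever `|q| > |q*_L|`. The inequality for `u'` at `r = 0` follows from the one
for `r > 0` by continuity. -/
def DynamicalHypothesis {d : ℕ} (W Φ : Space d → ℝ) : Prop :=
  ∃ (B : ℝ) (u : ℝ → ℝ) (qstar : ℕ → Space d),
    (∀ q, ‖gradient W q‖ < B) ∧
    ContDiff ℝ 2 u ∧
    (∀ q : Space d, q ≠ 0 → B + inner ℝ (gradient Φ q) (‖q‖⁻¹ • q) ≤ deriv u ‖q‖) ∧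
    Monotone (fun L => ‖qstar L‖) ∧
    Tendsto (fun L => ‖qstar L‖) atTop atTop ∧
    ∀ (L : ℕ) (q : Space d), ‖qstar L‖ < ‖q‖ → u ‖q‖ < u ‖qstar L‖

/-- Distributional convergence of measures: convergence of the integrals of all `φ ∈ C_c^∞`. -/
def DistribTendsto {d : ℕ} (μ : ℕ → Measure (Phase d)) (ν : Measure (Phase d)) : Prop :=
  ∀ φ : Phase d → ℝ, ContDiff ℝ ∞ φ → HasCompactSupport φ →
    Tendsto (fun k => ∫ x, φ x ∂(μ k)) atTop (𝓝 (∫ x, φ x ∂ν))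

/-- Continuity of a path of measures on `[0, T]` for the distributional convergence. -/
def DistribContinuousOn {d : ℕ} (T : ℝ) (μ : ℝ → Measure (Phase d)) : Prop :=
  ∀ φ : Phase d → ℝ, ContDiff ℝ ∞ φ → HasCompactSupport φ →
    ContinuousOn (fun t => ∫ x, φ x ∂(μ t)) (Icc 0 T)

/-- The integrand `∂_t φ + ⟨v, ∇φ⟩` of the weak formulation at time `t`. -/
noncomputable def transportIntegrand {d : ℕ} (v : Phase d → Phase d) (φ : ℝ × Phase d → ℝ)
    (t : ℝ) (x : Phase d) : ℝ :=
  deriv (fun s => φ (s, x)) t + inner ℝ (v x) (gradient (fun y => φ (t, y)) x)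

/-- `(μ_t)` solves the Hamiltonian ODE `∂_t μ + ∇·(J ∇_W ℋ(μ) μ) = 0` on `(0, T)` in the sense of
distributions: for all `φ ∈ C_c^∞((0, T) × ℝ^D)` the integrals exist and
`∫₀ᵀ ∫ (∂_t φ + ⟨J ∇_W ℋ(μ_t), ∇φ⟩) dμ_t dt = 0`. -/
def SolvesHamiltonianODE {d : ℕ} (W Φ : Space d → ℝ) (T : ℝ) (μ : ℝ → Measure (Phase d)) :
    Prop :=
  ∀ φ : ℝ × Phase d → ℝ, ContDiff ℝ ∞ φ → HasCompactSupport φ →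
    tsupport φ ⊆ Ioo 0 T ×ˢ univ →
    (∀ t ∈ Ioo 0 T, Integrable (transportIntegrand (hamVelocity W Φ (μ t)) φ t) (μ t)) ∧
    IntervalIntegrable
      (fun t => ∫ x, transportIntegrand (hamVelocity W Φ (μ t)) φ t x ∂(μ t)) volume 0 T ∧
    ∫ t in (0 : ℝ)..T, ∫ x, transportIntegrand (hamVelocity W Φ (μ t)) φ t x ∂(μ t) = 0

/-!
The scheme is handled on the level of trajectories. Every measure that occurs is the image of `μ₀`
under the flow of a force field `(p, q) ↦ (-(g(t, q) + ∇Φ(q)), p)`, weighted by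
`exp (-ε · length)` and with the mass removed whose trajectory has blown up
(`attenuatedTransport`). For the discretized measures, `g` is piecewise constant in time, with
values `∇(W * μ)` at the grid points (`AdmissiblePotentials.discretized_eq`). Each such `g` is
bounded by `b = max |∇W| < B` and Lipschitz in `q`, as all the measures have mass at most one.

The dynamical hypothesis enters through one fact (`confining_of_barriers`). For a force bounded by
`b`, the radius `r = |q|` satisfies `r'' ≥ (B - b) - u'(r)`, so `r'²/2 + u(r)` does not decrease
while `r' ≥ 0`; since `u < u(|q*_L|)` beyond `|q*_L|`, a particle that leaves the ball of radius
`|q*_L|` never returns (`norm_le_of_norm_endpoints_le`). Hence a trajectory that starts in a given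
ball of phase space and ends over a given ball of positions stays in a compact set that depends on
these two balls only, whatever the force.

Two consequences carry the limit. Integrals of observables that are supported over a bounded set of
positions are equicontinuous in time, uniformly in the force and in `ε`
(`exists_equicontinuous_integral`); applied to `∇W(q - ·)`, this makes the forces
`∇(W * μ_t)(q)` precompact for locally uniform convergence, by the theorem of Arzelà and Ascoli
(`AdmissiblePotentials.exists_limit_force`). And if the forces converge, then for every initial
point the value of such an observable along the approximating trajectories converges to its value
along the limit trajectory, or to zero if that one has blown up: an approximating trajectory which
ends over the support would be confined, and so the nearby limit trajectory would exist
(`tendsto_attenuated`). Dominated convergence then gives the convergence of the measures, and shows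
that the limit force is the one generated by the limit measures. The weak equation follows by Fubini
from the fundamental theorem of calculus along each trajectory
(`integral_fderiv_along_trajectory`): the test function, set to zero after blow-up, is continuous
also at the blow-up time, once more by confinement.
-/

/-! ### Retraction onto a ball and truncated vector fields -/

section Trajectories

variable {E : Type*} [NormedAddCommGroup E] [NormedSpace ℝ E]

/-- The radial retraction of a normed space onto the closed ball of radius `R > 0` about `0`. -/
noncomputable def ballRetract (R : ℝ) (x : E) : E := (R / max R ‖x‖) • x

theorem ballRetract_of_norm_le {R : ℝ} (hR : 0 < R) {x : E} (hx : ‖x‖ ≤ R) :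
    ballRetract R x = x := by
  simp [ballRetract, max_eq_left hx, div_self hR.ne']

theorem norm_ballRetract_le {R : ℝ} (hR : 0 < R) (x : E) : ‖ballRetract R x‖ ≤ R := by
  have hm : 0 < max R ‖x‖ := lt_max_of_lt_left hR
  rw [ballRetract, norm_smul, Real.norm_of_nonneg (by positivity), div_mul_eq_mul_div,
    div_le_iff₀ hm]
  exact mul_le_mul_of_nonneg_left (le_max_right _ _) hR.le

theorem lipschitzWith_ballRetract {R : ℝ} (hR : 0 < R) :
    LipschitzWith 2 (ballRetract R : E → E) := by
  refine LipschitzWith.of_dist_le_mul fun x y => ?_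
  simp only [dist_eq_norm, NNReal.coe_ofNat]
  wlog hxy : ‖x‖ ≤ ‖y‖ generalizing x y
  · have h := this y x (le_of_not_ge hxy)
    rwa [norm_sub_rev, norm_sub_rev y x] at h
  have hmx : 0 < max R ‖x‖ := lt_max_of_lt_left hR
  have hmy : 0 < max R ‖y‖ := lt_max_of_lt_left hR
  have h1 : ballRetract R x - ballRetract R y
      = (R / max R ‖y‖) • (x - y) + (R / max R ‖x‖ - R / max R ‖y‖) • x := by
    simp only [ballRetract, smul_sub, sub_smul]; abel
  have hc : |R / max R ‖x‖ - R / max R ‖y‖| * ‖x‖ ≤ ‖y‖ - ‖x‖ := by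
    have hle : max R ‖x‖ ≤ max R ‖y‖ := max_le_max le_rfl hxy
    have hdiff : max R ‖y‖ - max R ‖x‖ ≤ ‖y‖ - ‖x‖ := by
      rcases le_total R ‖y‖ with h | h
      · rw [max_eq_right h]; linarith [le_max_right R ‖x‖]
      · rw [max_eq_left h]; linarith [le_max_left R ‖x‖]
    have e : R / max R ‖x‖ - R / max R ‖y‖
        = R / max R ‖y‖ * ((max R ‖y‖ - max R ‖x‖) / max R ‖x‖) := by
      field_simp
    have hy1 : R / max R ‖y‖ ≤ 1 := (div_le_one hmy).2 (le_max_left _ _)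
    have hx1 : ‖x‖ / max R ‖x‖ ≤ 1 := (div_le_one hmx).2 (le_max_right _ _)
    have h0 : 0 ≤ max R ‖y‖ - max R ‖x‖ := sub_nonneg.2 hle
    rw [e, abs_of_nonneg (by positivity)]
    calc R / max R ‖y‖ * ((max R ‖y‖ - max R ‖x‖) / max R ‖x‖) * ‖x‖
        = (R / max R ‖y‖) * (‖x‖ / max R ‖x‖) * (max R ‖y‖ - max R ‖x‖) := by ring
      _ ≤ 1 * 1 * (max R ‖y‖ - max R ‖x‖) := by gcongr
      _ ≤ ‖y‖ - ‖x‖ := by linarith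
  have hy1 : R / max R ‖y‖ ≤ 1 := (div_le_one hmy).2 (le_max_left _ _)
  calc ‖ballRetract R x - ballRetract R y‖
      ≤ ‖(R / max R ‖y‖) • (x - y)‖ + ‖(R / max R ‖x‖ - R / max R ‖y‖) • x‖ := by
        rw [h1]; exact norm_add_le _ _
    _ ≤ 1 * ‖x - y‖ + (‖y‖ - ‖x‖) := by
        rw [norm_smul, norm_smul, Real.norm_of_nonneg (by positivity), Real.norm_eq_abs]
        gcongr
    _ ≤ 2 * ‖x - y‖ := by
        have := norm_sub_norm_le y x
        rw [norm_sub_rev] at this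
        linarith

/-- The vector field `v` frozen radially outside the ball of radius `R`. It agrees with `v` on the
ball, and is globally bounded and Lipschitz if `v` is locally so. -/
noncomputable def truncField (R : ℝ) (v : ℝ → E → E) (t : ℝ) (x : E) : E := v t (ballRetract R x)

/-! ### Trajectories of time-dependent vector fields -/

/-- `γ` is a trajectory of the time-dependent vector field `v` on `[0, t]`. Only the right
derivative is prescribed, so that fields which jump in time are allowed. -/
def IsTraj (v : ℝ → E → E) (t : ℝ) (γ : ℝ → E) : Prop :=
  ContinuousOn γ (Icc 0 t) ∧ ∀ s ∈ Ico 0 t, HasDerivWithinAt γ (v s (γ s)) (Ici s) s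

namespace IsTraj

variable {v w : ℝ → E → E} {s t : ℝ} {γ : ℝ → E}

theorem mono (h : IsTraj v t γ) (hst : s ≤ t) : IsTraj v s γ :=
  ⟨h.1.mono (Icc_subset_Icc_right hst), fun r hr => h.2 r ⟨hr.1, hr.2.trans_le hst⟩⟩

theorem congr_field (h : IsTraj v t γ) (hvw : ∀ r ∈ Ico 0 t, v r (γ r) = w r (γ r)) :
    IsTraj w t γ :=
  ⟨h.1, fun r hr => hvw r hr ▸ h.2 r hr⟩

theorem trunc (h : IsTraj v t γ) {R : ℝ} (hR : 0 < R) (hb : ∀ r ∈ Icc 0 t, ‖γ r‖ ≤ R) :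
    IsTraj (truncField R v) t γ :=
  h.congr_field fun r hr => by
    rw [truncField, ballRetract_of_norm_le hR (hb r (Ico_subset_Icc_self hr))]

theorem of_trunc {R : ℝ} (h : IsTraj (truncField R v) t γ) (hR : 0 < R)
    (hb : ∀ r ∈ Icc 0 t, ‖γ r‖ ≤ R) : IsTraj v t γ :=
  h.congr_field fun r hr => by
    rw [truncField, ballRetract_of_norm_le hR (hb r (Ico_subset_Icc_self hr))]

theorem exists_norm_le (h : IsTraj v t γ) : ∃ R > 0, ∀ r ∈ Icc 0 t, ‖γ r‖ ≤ R := by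
  obtain ⟨C, hC⟩ := isCompact_Icc.exists_bound_of_continuousOn h.1
  exact ⟨max C 1, by positivity, fun r hr => (hC r hr).trans (le_max_left _ _)⟩

theorem of_nonpos (v : ℝ → E → E) (γ : ℝ → E) (ht : t ≤ 0) : IsTraj v t γ := by
  refine ⟨?_, fun s hs => absurd (hs.1.trans_lt hs.2) (not_lt.2 ht)⟩
  exact Set.Subsingleton.continuousOn (fun a ha b hb => by
    have := ha.1; have := ha.2; have := hb.1; have := hb.2; linarith) _

theorem norm_sub_le (h : IsTraj v t γ) {M : ℝ} {a b : ℝ} (ha : 0 ≤ a) (hab : a ≤ b) (hbt : b ≤ t)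
    (hM : ∀ r ∈ Ico a b, ‖v r (γ r)‖ ≤ M) : ‖γ b - γ a‖ ≤ M * (b - a) :=
  norm_image_sub_le_of_norm_deriv_right_le_segment
    (h.1.mono (Icc_subset_Icc ha hbt))
    (fun r hr => h.2 r ⟨ha.trans hr.1, hr.2.trans_le hbt⟩) hM b ⟨hab, le_rfl⟩

theorem shift {a b : ℝ} (ha : 0 ≤ a) (h : IsTraj v (a + b) γ) :
    IsTraj (fun r => v (a + r)) b (fun r => γ (a + r)) := by
  refine ⟨h.1.comp (by fun_prop) fun r hr => ⟨by linarith [hr.1], by linarith [hr.2]⟩,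
    fun s hs => ?_⟩
  have h1 := h.2 (a + s) ⟨by linarith [hs.1], by linarith [hs.2]⟩
  have h2 : HasDerivWithinAt (fun r : ℝ => a + r) 1 (Ici s) s :=
    ((hasDerivAt_id s).const_add a).hasDerivWithinAt
  have := h1.scomp s h2 (fun r hr => by simpa using hr)
  simpa [Function.comp_def] using this

/-- Concatenation of trajectories. -/
theorem concat {a b : ℝ} (ha : 0 ≤ a) {γ' : ℝ → E} (h : IsTraj v a γ)
    (h' : IsTraj (fun r => v (a + r)) b γ') (h0 : γ' 0 = γ a) :
    IsTraj v (a + b) (fun r => if r < a then γ r else γ' (r - a)) := by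
  constructor
  · rcases lt_or_ge b 0 with hb | hb
    · refine (h.1.mono (Icc_subset_Icc_right (by linarith))).congr fun r hr => ?_
      have : r < a := by linarith [hr.2]
      simp [this]
    have e : Icc 0 (a + b) = Icc 0 a ∪ Icc a (a + b) := (Icc_union_Icc_eq_Icc ha (by linarith)).symm
    rw [e]
    refine ContinuousOn.union_of_isClosed ?_ ?_ isClosed_Icc isClosed_Icc
    · refine h.1.congr fun r hr => ?_
      rcases hr.2.lt_or_eq with h1 | h1
      · simp [h1]
      · simp [h1, h0]
    · have : ContinuousOn (fun r => γ' (r - a)) (Icc a (a + b)) :=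
        h'.1.comp (by fun_prop) fun r hr => ⟨by linarith [hr.1], by linarith [hr.2]⟩
      refine this.congr fun r hr => ?_
      simp [not_lt.2 hr.1]
  · intro s hs
    rcases lt_or_ge s a with h1 | h1
    · have h2 := h.2 s ⟨hs.1, h1⟩
      simp only [h1, if_true]
      refine h2.congr_of_eventuallyEq ?_ (by simp [h1])
      filter_upwards [mem_nhdsWithin_of_mem_nhds (Iio_mem_nhds h1)] with r hr
      have : r < a := hr
      simp [this]
    · have h2 := h'.2 (s - a) ⟨by linarith, by linarith [hs.2]⟩
      have h3 : HasDerivWithinAt (fun r : ℝ => r - a) 1 (Ici s) s :=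
        ((hasDerivAt_id s).sub_const a).hasDerivWithinAt
      have h4 := h2.scomp s h3 (fun r hr => by simpa using hr)
      simp only [not_lt.2 h1, if_false]
      simp only [add_sub_cancel, one_smul] at h4
      refine h4.congr (fun r hr => ?_) (by simp [not_lt.2 h1])
      have : ¬ r < a := not_lt.2 (h1.trans hr)
      simp [this]

end IsTraj

/-- Local Lipschitz continuity in space, uniformly for times in `[0, T]`. -/
def UnifLocLip (T : ℝ) (v : ℝ → E → E) : Prop :=
  ∀ R : ℝ, ∃ K : NNReal, ∀ t ∈ Icc 0 T, LipschitzOnWith K (v t) (Metric.closedBall 0 R)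

/-- The time-dependent vector field `v` on `[0, T]` is locally Lipschitz and locally bounded in
space, uniformly in time, jointly measurable, and its truncations to balls have global
trajectories. These conditions allow finite-time blow-up of the trajectories of `v` itself. -/
structure RegularField [MeasurableSpace E] (T : ℝ) (v : ℝ → E → E) : Prop where
  measurable : Measurable (Function.uncurry v)
  lip : UnifLocLip T v
  bdd : ∀ R : ℝ, ∃ M : ℝ, 0 < M ∧ ∀ t ∈ Icc 0 T, ∀ x : E, ‖x‖ ≤ R → ‖v t x‖ ≤ M
  exists_traj : ∀ R : ℝ, 0 < R → ∀ x : E, ∃ γ : ℝ → E, γ 0 = x ∧ IsTraj (truncField R v) T γ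

theorem lipschitzWith_truncField {R : ℝ} (hR : 0 < R) {v : ℝ → E → E} {K : NNReal} {t : ℝ}
    (hv : LipschitzOnWith K (v t) (Metric.closedBall 0 R)) :
    LipschitzWith (K * 2) (truncField R v t) := by
  rw [← lipschitzOnWith_univ]
  exact hv.comp (lipschitzWith_ballRetract hR).lipschitzOnWith
    fun x _ => by simpa using norm_ballRetract_le hR x

/-- Trajectories of approximating truncated fields stay close to those of the truncated field. -/
theorem dist_truncated_traj_le {R T : ℝ} (hR : 0 < R) {v w : ℝ → E → E} {K : NNReal} {δ η : ℝ}
    (hv : ∀ t ∈ Icc 0 T, LipschitzOnWith K (v t) (Metric.closedBall 0 R))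
    (hvw : ∀ t ∈ Icc 0 T, ∀ x : E, ‖x‖ ≤ R → ‖w t x - v t x‖ ≤ η)
    {γ γ' : ℝ → E} (hγ : IsTraj (truncField R v) T γ) (hγ' : IsTraj (truncField R w) T γ')
    (h0 : dist (γ' 0) (γ 0) ≤ δ) :
    ∀ t ∈ Icc 0 T, dist (γ' t) (γ t) ≤ gronwallBound δ (K * 2 : NNReal) η t := by
  intro t ht
  have := dist_le_of_approx_trajectories_ODE_of_mem (v := truncField R v) (s := fun _ => univ)
    (K := K * 2) (a := 0) (b := T) (εf := η) (εg := 0) (δ := δ) (f := γ') (g := γ)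
    (f' := fun s => truncField R w s (γ' s)) (g' := fun s => truncField R v s (γ s))
    (fun s hs => (lipschitzWith_truncField hR (hv s (Ico_subset_Icc_self hs))).lipschitzOnWith)
    hγ'.1 hγ'.2
    (fun s hs => by
      rw [dist_eq_norm]
      exact hvw s (Ico_subset_Icc_self hs) _ (norm_ballRetract_le hR _))
    (fun _ _ => mem_univ _) hγ.1 hγ.2 (fun s _ => by simp) (fun _ _ => mem_univ _) h0 t ht
  simpa using this

end Trajectories

/-! ### Flows with finite-time blow-up -/

section Flows

variable {E : Type*} [NormedAddCommGroup E] [NormedSpace ℝ E]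

/-- The initial points whose trajectory along `v` exists on the whole of `[0, t]`. -/
def lifeSet (v : ℝ → E → E) (t : ℝ) : Set E := {x | ∃ γ : ℝ → E, γ 0 = x ∧ IsTraj v t γ}

open Classical in
/-- The flow of the time-dependent field `v` from time `0` to time `t`, extended by the identity to
the points whose trajectory blows up before time `t`. -/
noncomputable def timeFlow (v : ℝ → E → E) (t : ℝ) (x : E) : E :=
  if h : x ∈ lifeSet v t then h.choose t else x

theorem timeFlow_of_notMem {v : ℝ → E → E} {t : ℝ} {x : E} (h : x ∉ lifeSet v t) :
    timeFlow v t x = x := dif_neg h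

theorem lifeSet_anti (v : ℝ → E → E) {s t : ℝ} (hst : s ≤ t) : lifeSet v t ⊆ lifeSet v s :=
  fun _ ⟨γ, h0, h⟩ => ⟨γ, h0, h.mono hst⟩

theorem mem_lifeSet_zero (v : ℝ → E → E) (x : E) : x ∈ lifeSet v 0 :=
  ⟨fun _ => x, rfl, IsTraj.of_nonpos _ _ le_rfl⟩

theorem timeFlow_zero (v : ℝ → E → E) (x : E) : timeFlow v 0 x = x := by
  rw [timeFlow, dif_pos (mem_lifeSet_zero v x)]
  exact (mem_lifeSet_zero v x).choose_spec.1

theorem UnifLocLip.trunc {T : ℝ} {v : ℝ → E → E} (hv : UnifLocLip T v) {R : ℝ} (hR : 0 < R) :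
    UnifLocLip T (truncField R v) := fun _ => by
  obtain ⟨K, hK⟩ := hv R
  exact ⟨K * 2, fun t ht => (lipschitzWith_truncField hR (hK t ht)).lipschitzOnWith⟩

theorem IsTraj.eqOn {T t : ℝ} {v : ℝ → E → E} (hv : UnifLocLip T v) (htT : t ≤ T) {γ γ' : ℝ → E}
    (hγ : IsTraj v t γ) (hγ' : IsTraj v t γ') (h0 : γ 0 = γ' 0) : EqOn γ γ' (Icc 0 t) := by
  obtain ⟨R, -, hR⟩ := hγ.exists_norm_le
  obtain ⟨R', -, hR'⟩ := hγ'.exists_norm_le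
  obtain ⟨K, hK⟩ := hv (max R R')
  intro s hs
  have := dist_le_of_trajectories_ODE_of_mem (v := v)
    (s := fun _ => Metric.closedBall 0 (max R R')) (K := K) (δ := 0)
    (fun r hr => hK r ⟨hr.1, hr.2.le.trans htT⟩) hγ.1 hγ.2
    (fun r hr => by simpa using Or.inl (hR r (Ico_subset_Icc_self hr))) hγ'.1 hγ'.2
    (fun r hr => by simpa using Or.inr (hR' r (Ico_subset_Icc_self hr))) (by simp [h0]) s hs
  rw [zero_mul] at this
  exact dist_le_zero.1 this

theorem IsTraj.timeFlow_eq {T s t : ℝ} {v : ℝ → E → E} (hv : UnifLocLip T v) {γ : ℝ → E}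
    (hγ : IsTraj v t γ) (hs : 0 ≤ s) (hst : s ≤ t) (htT : t ≤ T) : timeFlow v s (γ 0) = γ s := by
  have hmem : γ 0 ∈ lifeSet v s := ⟨γ, rfl, hγ.mono hst⟩
  rw [timeFlow, dif_pos hmem]
  exact IsTraj.eqOn hv (hst.trans htT) hmem.choose_spec.2 (hγ.mono hst) hmem.choose_spec.1
    ⟨hs, le_rfl⟩

theorem isTraj_timeFlow {T t : ℝ} {v : ℝ → E → E} (hv : UnifLocLip T v) (htT : t ≤ T) {x : E}
    (hx : x ∈ lifeSet v t) : IsTraj v t (fun s => timeFlow v s x) := by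
  obtain ⟨γ, rfl, hγ⟩ := hx
  have heq : ∀ s ∈ Icc 0 t, timeFlow v s (γ 0) = γ s :=
    fun s hs => hγ.timeFlow_eq hv hs.1 hs.2 htT
  refine ⟨hγ.1.congr heq, fun s hs => ?_⟩
  beta_reduce
  rw [heq s (Ico_subset_Icc_self hs)]
  refine (hγ.2 s hs).congr_of_eventuallyEq ?_ (heq s (Ico_subset_Icc_self hs))
  filter_upwards [Icc_mem_nhdsGE_of_mem hs] with r hr
  exact heq r hr

section Truncated

variable {T R : ℝ} {v : ℝ → E → E}

theorem continuousOn_timeFlow_of_lipschitzWith {K : NNReal} (hv : UnifLocLip T v)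
    (hK : ∀ t ∈ Icc 0 T, LipschitzWith K (v t)) (hex : ∀ x, x ∈ lifeSet v T) :
    ContinuousOn (fun p : ℝ × E => timeFlow v p.1 p.2) (Icc 0 T ×ˢ univ) := by
  refine continuousOn_prod_of_continuousOn_lipschitzOnWith' _ (Real.toNNReal (Real.exp (K * T)))
    (fun t ht => ?_) (fun x _ => (isTraj_timeFlow hv le_rfl (hex x)).1)
  refine LipschitzWith.lipschitzOnWith (LipschitzWith.of_dist_le_mul fun x y => ?_)
  rw [Real.coe_toNNReal _ (Real.exp_pos _).le]
  have hx := isTraj_timeFlow hv le_rfl (hex x)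
  have hy := isTraj_timeFlow hv le_rfl (hex y)
  have := dist_le_of_trajectories_ODE_of_mem (v := v)
    (s := fun _ => univ) (K := K) (δ := dist x y)
    (fun r hr => (hK r (Ico_subset_Icc_self hr)).lipschitzOnWith) hx.1 hx.2
    (fun r hr => mem_univ _) hy.1 hy.2
    (fun r hr => mem_univ _) (by simp [timeFlow_zero]) t ht
  refine this.trans ?_
  rw [mul_comm, sub_zero]
  gcongr
  exact ht.2

end Truncated

/-- The factor `exp (-ε · length)` collected along the trajectory of `x` on `[0, t]`, and zero if
the trajectory does not exist on `[0, t]`. -/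
noncomputable def attenuation (ε : ℝ) (v : ℝ → E → E) (t : ℝ) : E → ℝ :=
  (lifeSet v t).indicator fun x => Real.exp (-(∫ r in (0 : ℝ)..t, ε * ‖v r (timeFlow v r x)‖))

theorem attenuation_nonneg (ε : ℝ) (v : ℝ → E → E) (t : ℝ) (x : E) : 0 ≤ attenuation ε v t x :=
  indicator_nonneg (fun _ _ => (Real.exp_pos _).le) x

theorem attenuation_le_one {ε : ℝ} (hε : 0 ≤ ε) (v : ℝ → E → E) {t : ℝ} (ht : 0 ≤ t) (x : E) :
    attenuation ε v t x ≤ 1 := by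
  refine indicator_le' (fun x _ => ?_) (fun _ _ => zero_le_one) x
  rw [Real.exp_le_one_iff, neg_nonpos]
  exact intervalIntegral.integral_nonneg ht fun r _ => by positivity

section Confinement

variable {T : ℝ} {v : ℝ → E → E}

/-- Projection of the time axis onto `[0, T]`. -/
noncomputable def clampTime (T t : ℝ) : ℝ := max 0 (min T t)

theorem continuous_clampTime : Continuous (clampTime T) := by unfold clampTime; fun_prop

theorem clampTime_mem (hT : 0 ≤ T) (t : ℝ) : clampTime T t ∈ Icc 0 T :=
  ⟨le_max_left _ _, max_le hT (min_le_left _ _)⟩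

theorem clampTime_of_mem {t : ℝ} (ht : t ∈ Icc 0 T) : clampTime T t = t := by
  rw [clampTime, min_eq_right ht.2, max_eq_right ht.1]

/-- The pairs `(t, x)` such that the truncated trajectory of `x` stays in the ball of radius `R` on
`[0, t]`, with `t` projected to `[0, T]`. The times in `[0, t]` are written as `θ t` with `θ` in
`[0, 1]`, so that the set is visibly an intersection of closed sets. -/
def confinedSet (T R : ℝ) (v : ℝ → E → E) : Set (ℝ × E) :=
  {p | ∀ θ ∈ Icc (0 : ℝ) 1, ‖timeFlow (truncField R v) (θ * clampTime T p.1) p.2‖ ≤ R}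

theorem mem_confinedSet {R : ℝ} {p : ℝ × E} (hT : 0 ≤ T) :
    p ∈ confinedSet T R v ↔
      ∀ s ∈ Icc 0 (clampTime T p.1), ‖timeFlow (truncField R v) s p.2‖ ≤ R := by
  have h0 := (clampTime_mem hT p.1).1
  constructor
  · intro h s hs
    rcases h0.eq_or_lt with h1 | h1
    · have : s = 0 := le_antisymm (by simpa [← h1] using hs.2) hs.1
      have h2 := h 0 (by simp)
      rwa [zero_mul, ← this] at h2
    · have h2 := h (s / clampTime T p.1) ⟨div_nonneg hs.1 h0, (div_le_one h1).2 hs.2⟩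
      rwa [div_mul_cancel₀ _ h1.ne'] at h2
  · intro h θ hθ
    exact h _ ⟨mul_nonneg hθ.1 h0, mul_le_of_le_one_left h0 hθ.2⟩

end Confinement

end Flows

/-! ### Measurability of the flow -/

section FlowMeasurability

variable {E : Type*} [NormedAddCommGroup E] [NormedSpace ℝ E] [MeasurableSpace E] {T : ℝ}
  {v : ℝ → E → E}

theorem RegularField.mem_lifeSet_trunc (hv : RegularField T v) {R : ℝ} (hR : 0 < R) (x : E) :
    x ∈ lifeSet (truncField R v) T := hv.exists_traj R hR x

theorem RegularField.isTraj_truncFlow (hv : RegularField T v) {R : ℝ} (hR : 0 < R) (x : E) :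
    IsTraj (truncField R v) T (fun s => timeFlow (truncField R v) s x) :=
  isTraj_timeFlow (hv.lip.trunc hR) le_rfl (hv.mem_lifeSet_trunc hR x)

theorem RegularField.continuous_truncFlow (hv : RegularField T v) (hT : 0 ≤ T) {R : ℝ}
    (hR : 0 < R) :
    Continuous (fun p : ℝ × E => timeFlow (truncField R v) (clampTime T p.1) p.2) := by
  obtain ⟨K, hK⟩ := hv.lip R
  have := continuousOn_timeFlow_of_lipschitzWith (hv.lip.trunc hR)
    (fun t ht => lipschitzWith_truncField hR (hK t ht)) (hv.mem_lifeSet_trunc hR)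
  have h2 := this.comp_continuous (f := fun p : ℝ × E => (clampTime T p.1, p.2))
    (by have := continuous_clampTime (T := T); fun_prop)
    (fun p => ⟨clampTime_mem hT _, mem_univ _⟩)
  exact h2

/-- A trajectory of a truncated field that stays in the ball is a trajectory of the field. -/
theorem RegularField.truncFlow_eq (hv : RegularField T v) {R : ℝ} (hR : 0 < R) {x : E} {t : ℝ}
    (htT : t ≤ T)
    (hb : ∀ s ∈ Icc 0 t, ‖timeFlow (truncField R v) s x‖ ≤ R) :
    x ∈ lifeSet v t ∧ ∀ s ∈ Icc 0 t, timeFlow v s x = timeFlow (truncField R v) s x := by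
  have h := ((hv.isTraj_truncFlow hR x).mono htT).of_trunc hR hb
  refine ⟨⟨_, timeFlow_zero _ x, h⟩, fun s hs => ?_⟩
  have := h.timeFlow_eq hv.lip hs.1 hs.2 htT
  simpa [timeFlow_zero] using this

/-- A bounded trajectory of the field is a trajectory of the truncated field. -/
theorem RegularField.truncFlow_eq' (hv : RegularField T v) {R : ℝ} (hR : 0 < R) {x : E} {t : ℝ}
    (htT : t ≤ T) (hx : x ∈ lifeSet v t)
    (hb : ∀ s ∈ Icc 0 t, ‖timeFlow v s x‖ ≤ R) :
    ∀ s ∈ Icc 0 t, timeFlow (truncField R v) s x = timeFlow v s x := by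
  intro s hs
  have h := (isTraj_timeFlow hv.lip htT hx).trunc hR hb
  have := h.timeFlow_eq (hv.lip.trunc hR) hs.1 hs.2 htT
  simpa [timeFlow_zero] using this

theorem RegularField.isClosed_confinedSet (hv : RegularField T v) (hT : 0 ≤ T) {R : ℝ}
    (hR : 0 < R) : IsClosed (confinedSet T R v) := by
  have : confinedSet T R v = ⋂ θ ∈ Icc (0 : ℝ) 1,
      {p : ℝ × E | ‖timeFlow (truncField R v) (θ * clampTime T p.1) p.2‖ ≤ R} := by
    ext p; simp [confinedSet]
  rw [this]
  refine isClosed_biInter fun θ hθ => isClosed_le ?_ continuous_const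
  have h1 : Continuous fun p : ℝ × E => (θ * clampTime T p.1, p.2) := by
    have := continuous_clampTime (T := T); fun_prop
  have h2 := (hv.continuous_truncFlow hT hR).comp h1
  refine h2.norm.congr fun p => ?_
  have h0 := clampTime_mem hT p.1
  simp only [Function.comp]
  rw [clampTime_of_mem ⟨mul_nonneg hθ.1 h0.1, (mul_le_of_le_one_left h0.1 hθ.2).trans h0.2⟩]

theorem RegularField.mem_lifeSet_iff (hv : RegularField T v) (hT : 0 ≤ T) (p : ℝ × E) :
    p.2 ∈ lifeSet v (clampTime T p.1) ↔
      ∀ᶠ N : ℕ in atTop, p ∈ confinedSet T (N + 1) v := by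
  have hc := clampTime_mem hT p.1
  constructor
  · intro h
    obtain ⟨R, -, hR⟩ := (isTraj_timeFlow hv.lip hc.2 h).exists_norm_le
    filter_upwards [eventually_ge_atTop ⌈R⌉₊] with N hN
    have hN' : R ≤ N + 1 := (Nat.le_ceil R).trans ((Nat.cast_le.2 hN).trans (by linarith))
    rw [mem_confinedSet hT]
    intro s hs
    rw [hv.truncFlow_eq' (by positivity) hc.2 h (fun s hs => (hR s hs).trans hN') s hs]
    exact (hR s hs).trans hN'
  · intro h
    obtain ⟨N, hN⟩ := h.exists
    rw [mem_confinedSet hT] at hN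
    exact (hv.truncFlow_eq (by positivity) hc.2 hN).1

/-- The transport of `μ` along the time-dependent field `v` from time `0` to time `t`, with
attenuation rate `ε |v|`, and with loss of the mass that blows up. -/
noncomputable def attenuatedTransport (ε : ℝ) (v : ℝ → E → E) (t : ℝ) (μ : Measure E) :
    Measure E :=
  (μ.withDensity fun x => ENNReal.ofReal (attenuation ε v t x)).map (timeFlow v t)

theorem attenuatedTransport_univ_le {ε : ℝ} (hε : 0 ≤ ε) {t : ℝ} (ht : 0 ≤ t) (μ : Measure E) :
    attenuatedTransport ε v t μ univ ≤ μ univ := by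
  by_cases h : AEMeasurable (timeFlow v t)
    (μ.withDensity fun x => ENNReal.ofReal (attenuation ε v t x))
  · rw [attenuatedTransport, Measure.map_apply_of_aemeasurable h MeasurableSet.univ, preimage_univ,
      withDensity_apply _ MeasurableSet.univ, Measure.restrict_univ]
    calc ∫⁻ x, ENNReal.ofReal (attenuation ε v t x) ∂μ ≤ ∫⁻ _, 1 ∂μ :=
          lintegral_mono fun x => by simpa using attenuation_le_one hε v ht x
      _ = μ univ := by simp
  · rw [attenuatedTransport, Measure.map_of_not_aemeasurable h]; simp

theorem attenuatedTransport_zero_time (ε : ℝ) (v : ℝ → E → E) (μ : Measure E) :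
    attenuatedTransport ε v 0 μ = μ := by
  have h1 : timeFlow v 0 = id := funext (timeFlow_zero v)
  have h2 : (fun x => ENNReal.ofReal (attenuation ε v 0 x)) = 1 := by
    ext x; simp [attenuation, indicator_of_mem (mem_lifeSet_zero _ x)]
  rw [attenuatedTransport, h1, h2, withDensity_one, Measure.map_id]

variable [BorelSpace E] [SecondCountableTopology E]

theorem RegularField.measurableSet_lifeSet_prod (hv : RegularField T v) (hT : 0 ≤ T) :
    MeasurableSet {p : ℝ × E | p.2 ∈ lifeSet v (clampTime T p.1)} := by
  have : {p : ℝ × E | p.2 ∈ lifeSet v (clampTime T p.1)}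
      = ⋃ N : ℕ, ⋂ n ≥ N, confinedSet T ((n : ℝ) + 1) v := by
    ext p
    simp only [mem_ofPred_eq, hv.mem_lifeSet_iff hT p, eventually_atTop, mem_iUnion, mem_iInter]
  rw [this]
  exact MeasurableSet.iUnion fun N => MeasurableSet.iInter fun n => MeasurableSet.iInter fun _ =>
    (hv.isClosed_confinedSet hT (by positivity)).measurableSet

theorem RegularField.measurableSet_lifeSet (hv : RegularField T v) {t : ℝ} (ht : t ∈ Icc 0 T) :
    MeasurableSet (lifeSet v t) := by
  have := (hv.measurableSet_lifeSet_prod (ht.1.trans ht.2)).preimage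
    (measurable_prodMk_left (x := t))
  simpa [clampTime_of_mem ht, preimage] using this

open Classical in
/-- Joint measurability of the flow in time and space: on the set where the trajectory exists it is
the limit of the truncated flows, each of which is continuous. -/
theorem RegularField.measurable_timeFlow_prod (hv : RegularField T v) (hT : 0 ≤ T) :
    Measurable (fun p : ℝ × E => timeFlow v (clampTime T p.1) p.2) := by
  let F : ℕ → ℝ × E → E := fun N p => if p ∈ confinedSet T ((N : ℝ) + 1) v then
    timeFlow (truncField ((N : ℝ) + 1) v) (clampTime T p.1) p.2 else p.2
  have hF : ∀ N, Measurable (F N) := fun N =>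
    Measurable.ite (hv.isClosed_confinedSet hT (by positivity)).measurableSet
      (hv.continuous_truncFlow hT (by positivity)).measurable measurable_snd
  refine measurable_of_tendsto_metrizable hF (tendsto_pi_nhds.2 fun p => ?_)
  have hc := clampTime_mem hT p.1
  refine tendsto_const_nhds.congr' ?_
  by_cases h : p.2 ∈ lifeSet v (clampTime T p.1)
  · filter_upwards [(hv.mem_lifeSet_iff hT p).1 h] with N hN
    simp only [F, hN, if_true]
    rw [mem_confinedSet hT] at hN
    exact (hv.truncFlow_eq (by positivity) hc.2 hN).2 _ ⟨hc.1, le_rfl⟩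
  · refine Eventually.of_forall fun N => ?_
    have hN : p ∉ confinedSet T ((N : ℝ) + 1) v := fun hN => h <| by
      rw [mem_confinedSet hT] at hN
      exact (hv.truncFlow_eq (by positivity) hc.2 hN).1
    simp only [F, hN, if_false, timeFlow_of_notMem h]

theorem RegularField.measurable_timeFlow (hv : RegularField T v) {t : ℝ} (ht : t ∈ Icc 0 T) :
    Measurable (timeFlow v t) := by
  have := (hv.measurable_timeFlow_prod (ht.1.trans ht.2)).comp (measurable_prodMk_left (x := t))
  simpa [clampTime_of_mem ht, Function.comp_def] using this

/-! ### Attenuated transport of measures -/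

theorem RegularField.measurable_speed (hv : RegularField T v) (hT : 0 ≤ T) :
    Measurable (fun p : ℝ × E => v p.1 (timeFlow v (clampTime T p.1) p.2)) :=
  hv.measurable.comp (measurable_fst.prodMk (hv.measurable_timeFlow_prod hT))

theorem RegularField.measurable_attenuation (hv : RegularField T v) (ε : ℝ) {t : ℝ}
    (ht : t ∈ Icc 0 T) : Measurable (attenuation ε v t) := by
  refine Measurable.indicator ?_ (hv.measurableSet_lifeSet ht)
  have h1 : ∀ x, (∫ r in (0 : ℝ)..t, ε * ‖v r (timeFlow v r x)‖)
      = ∫ r in Ioc 0 t, ε * ‖v r (timeFlow v (clampTime T r) x)‖ := fun x => by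
    rw [intervalIntegral.integral_of_le ht.1]
    refine setIntegral_congr_fun measurableSet_Ioc fun r hr => ?_
    simp only [clampTime_of_mem (⟨hr.1.le, hr.2.trans ht.2⟩ : r ∈ Icc 0 T)]
  simp only [h1]
  refine Real.measurable_exp.comp (Measurable.neg ?_)
  refine (StronglyMeasurable.integral_prod_left (f := fun r x =>
    ε * ‖v r (timeFlow v (clampTime T r) x)‖) ?_).measurable
  exact ((hv.measurable_speed (ht.1.trans ht.2)).norm.const_mul ε).stronglyMeasurable

/-- The speed along a trajectory is integrable. -/
theorem RegularField.intervalIntegrable_speed (hv : RegularField T v) {t : ℝ}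
    (ht : t ∈ Icc 0 T) {x : E} (hx : x ∈ lifeSet v t) (ε : ℝ) {a b : ℝ} (ha : a ∈ Icc 0 t)
    (hb : b ∈ Icc 0 t) :
    IntervalIntegrable (fun r => ε * ‖v r (timeFlow v r x)‖) volume a b := by
  have hI : IntervalIntegrable (fun r => ε * ‖v r (timeFlow v r x)‖) volume 0 t := by
    rw [intervalIntegrable_iff_integrableOn_Ioc_of_le ht.1]
    obtain ⟨R, -, hR⟩ := (isTraj_timeFlow hv.lip ht.2 hx).exists_norm_le
    obtain ⟨M, hM0, hM⟩ := hv.bdd R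
    have hmeas : Measurable fun r => ε * ‖v r (timeFlow v (clampTime T r) x)‖ :=
      ((hv.measurable_speed (ht.1.trans ht.2)).comp
        (measurable_prodMk_right (y := x))).norm.const_mul ε
    refine IntegrableOn.congr_fun (f := fun r => ε * ‖v r (timeFlow v (clampTime T r) x)‖) ?_
      (fun r hr => ?_) measurableSet_Ioc
    · refine Measure.integrableOn_of_bounded (M := |ε| * M) (by simp) hmeas.aestronglyMeasurable ?_
      refine (ae_restrict_mem measurableSet_Ioc).mono fun r hr => ?_
      have hr' : r ∈ Icc 0 T := ⟨hr.1.le, hr.2.trans ht.2⟩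
      rw [clampTime_of_mem hr', norm_mul, norm_norm, Real.norm_eq_abs]
      exact mul_le_mul_of_nonneg_left (hM r hr' _ (hR r ⟨hr.1.le, hr.2⟩)) (abs_nonneg _)
    · simp only [clampTime_of_mem (⟨hr.1.le, hr.2.trans ht.2⟩ : r ∈ Icc 0 T)]
  refine hI.mono_set ?_
  rw [uIcc_of_le ht.1]
  exact uIcc_subset_Icc ha hb

theorem RegularField.integral_attenuatedTransport {F : Type*} [NormedAddCommGroup F]
    [NormedSpace ℝ F] (hv : RegularField T v) (ε : ℝ) {t : ℝ} (ht : t ∈ Icc 0 T)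
    (μ : Measure E) {ψ : E → F} (hψ : StronglyMeasurable ψ) :
    ∫ y, ψ y ∂(attenuatedTransport ε v t μ)
      = ∫ x, attenuation ε v t x • ψ (timeFlow v t x) ∂μ := by
  rw [attenuatedTransport, integral_map (hv.measurable_timeFlow ht).aemeasurable
    hψ.aestronglyMeasurable, integral_withDensity_eq_integral_toReal_smul
    (hv.measurable_attenuation ε ht).ennreal_ofReal (by simp)]
  simp only [ENNReal.toReal_ofReal (attenuation_nonneg _ _ _ _)]

end FlowMeasurability

/-! ### Concatenation of attenuated transports -/

section Semigroup

variable {E : Type*} [NormedAddCommGroup E] [NormedSpace ℝ E] {v w : ℝ → E → E} {a b T : ℝ}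

theorem mem_lifeSet_add_iff (hv : UnifLocLip T v) (ha : 0 ≤ a) (hb : 0 ≤ b) (hab : a + b ≤ T)
    (hvw : ∀ r ∈ Ico 0 b, w r = v (a + r)) {x : E} :
    x ∈ lifeSet v (a + b) ↔ x ∈ lifeSet v a ∧ timeFlow v a x ∈ lifeSet w b := by
  constructor
  · intro hx
    have h := isTraj_timeFlow hv hab hx
    refine ⟨lifeSet_anti v (by linarith) hx, fun r => timeFlow v (a + r) x, by simp, ?_⟩
    exact (h.shift ha).congr_field fun r hr => by rw [hvw r hr]
  · rintro ⟨hx, γ, h0, hγ⟩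
    have h := isTraj_timeFlow hv (by linarith) hx
    refine ⟨_, ?_, h.concat ha (γ' := γ) (b := b) ?_ h0⟩
    · rcases ha.eq_or_lt with h1 | h1
      · subst h1; simp [h0, timeFlow_zero]
      · simp [h1, timeFlow_zero]
    · exact hγ.congr_field fun r hr => by rw [hvw r hr]

theorem timeFlow_add (hv : UnifLocLip T v) (hw : UnifLocLip b w) (ha : 0 ≤ a)
    (hab : a + b ≤ T) (hvw : ∀ r ∈ Ico 0 b, w r = v (a + r)) {x : E}
    (hx : x ∈ lifeSet v (a + b)) {r : ℝ} (hr : r ∈ Icc 0 b) :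
    timeFlow v (a + r) x = timeFlow w r (timeFlow v a x) := by
  have h := isTraj_timeFlow hv hab hx
  have h2 : IsTraj w b (fun r => timeFlow v (a + r) x) :=
    (h.shift ha).congr_field fun r hr => by rw [hvw r hr]
  have := h2.timeFlow_eq hw hr.1 hr.2 le_rfl
  rw [← this, add_zero]

theorem attenuation_add [MeasurableSpace E] [BorelSpace E] [SecondCountableTopology E]
    (hv : RegularField T v) (hw : UnifLocLip b w) (ha : 0 ≤ a)
    (hb : 0 ≤ b) (hab : a + b ≤ T) (hvw : ∀ r ∈ Ico 0 b, w r = v (a + r)) (ε : ℝ) (x : E) :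
    attenuation ε v (a + b) x
      = attenuation ε v a x * attenuation ε w b (timeFlow v a x) := by
  have hiff := mem_lifeSet_add_iff hv.lip ha hb hab hvw (x := x)
  by_cases hx : x ∈ lifeSet v (a + b)
  · obtain ⟨h1, h2⟩ := hiff.1 hx
    rw [attenuation, attenuation, attenuation, indicator_of_mem hx, indicator_of_mem h1,
      indicator_of_mem h2, ← Real.exp_add, ← neg_add]
    congr 2
    have habT : a + b ∈ Icc 0 T := ⟨by linarith, hab⟩
    rw [← intervalIntegral.integral_add_adjacent_intervals
      (hv.intervalIntegrable_speed habT hx ε ⟨le_rfl, habT.1⟩ ⟨ha, by linarith⟩)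
      (hv.intervalIntegrable_speed habT hx ε ⟨ha, by linarith⟩ ⟨habT.1, le_rfl⟩)]
    congr 1
    have := intervalIntegral.integral_comp_add_left (a := 0) (b := b)
      (fun r => ε * ‖v r (timeFlow v r x)‖) a
    rw [add_zero] at this
    rw [← this, intervalIntegral.integral_of_le hb, intervalIntegral.integral_of_le hb,
      integral_Ioc_eq_integral_Ioo, integral_Ioc_eq_integral_Ioo]
    refine setIntegral_congr_fun measurableSet_Ioo fun r hr => ?_
    rw [timeFlow_add hv.lip hw ha hab hvw hx ⟨hr.1.le, hr.2.le⟩, hvw r ⟨hr.1.le, hr.2⟩]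
  · rw [attenuation, indicator_of_notMem hx]
    rw [hiff, not_and_or] at hx
    rcases hx with h | h
    · rw [attenuation, indicator_of_notMem h, zero_mul]
    · rw [attenuation, attenuation, indicator_of_notMem h, mul_zero]

theorem withDensity_map {α β : Type*} [MeasurableSpace α] [MeasurableSpace β] {f : α → β}
    (hf : Measurable f) {g : β → ℝ≥0∞} (hg : Measurable g) (μ : Measure α) :
    (μ.map f).withDensity g = (μ.withDensity (g ∘ f)).map f := by
  ext s hs
  rw [withDensity_apply _ hs, Measure.map_apply hf hs, withDensity_apply _ (hf hs),
    setLIntegral_map hs hg hf]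
  rfl

/-- Transport along `v` on `[0, a + b]` is transport on `[0, a]` followed by transport along the
time-shifted field. -/
theorem attenuatedTransport_add [MeasurableSpace E] [BorelSpace E] [SecondCountableTopology E]
    (hv : RegularField T v) (hw : RegularField b w) (ha : 0 ≤ a)
    (hb : 0 ≤ b) (hab : a + b ≤ T) (hvw : ∀ r ∈ Ico 0 b, w r = v (a + r)) (ε : ℝ)
    (μ : Measure E) :
    attenuatedTransport ε w b (attenuatedTransport ε v a μ)
      = attenuatedTransport ε v (a + b) μ := by
  have haT : a ∈ Icc 0 T := ⟨ha, by linarith⟩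
  have hbb : b ∈ Icc 0 b := ⟨hb, le_rfl⟩
  have hXa := hv.measurable_timeFlow haT
  have hYb := hw.measurable_timeFlow hbb
  have hfa := (hv.measurable_attenuation ε haT).ennreal_ofReal
  have hgb := (hw.measurable_attenuation ε hbb).ennreal_ofReal
  have hfab := (hv.measurable_attenuation ε (⟨by linarith, hab⟩ : a + b ∈ Icc 0 T)).ennreal_ofReal
  rw [attenuatedTransport, attenuatedTransport, attenuatedTransport, withDensity_map hXa hgb,
    Measure.map_map hYb hXa, ← withDensity_mul _ hfa (hgb.comp hXa)]
  have e : ((fun x => ENNReal.ofReal (attenuation ε v a x)) *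
      (fun x => ENNReal.ofReal (attenuation ε w b x)) ∘ timeFlow v a)
      = fun x => ENNReal.ofReal (attenuation ε v (a + b) x) := by
    ext x
    simp only [Pi.mul_apply, Function.comp]
    rw [← ENNReal.ofReal_mul (attenuation_nonneg _ _ _ _),
      ← attenuation_add hv hw.lip ha hb hab hvw]
  rw [e]
  -- the two flow maps differ where the trajectory does not exist, but there the density vanishes
  refine Measure.map_congr ?_
  rw [EventuallyEq, ae_withDensity_iff hfab]
  refine Eventually.of_forall fun x hx => ?_
  have hx' : x ∈ lifeSet v (a + b) := by
    by_contra h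
    exact hx (by rw [attenuation, indicator_of_notMem h, ENNReal.ofReal_zero])
  exact (timeFlow_add hv.lip hw.lip ha hab hvw hx' ⟨hb, le_rfl⟩).symm

end Semigroup

/-! ### Existence of truncated trajectories -/

section Existence

theorem floor_grid_add {τ r : ℝ} (hτ : 0 < τ) (k : ℕ) (hr : r ∈ Ico 0 τ) :
    ⌊(k * τ + r) / τ⌋₊ = k := by
  rw [Nat.floor_eq_iff (by have := hr.1; positivity), le_div_iff₀ hτ, div_lt_iff₀ hτ]
  constructor <;> nlinarith [hr.1, hr.2]

theorem grid_floor_mem {T : ℝ} {n : ℕ} (hT : 0 < T) (hn : 0 < n) {t : ℝ} (ht : t ∈ Icc 0 T) :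
    ⌊t / (T / n)⌋₊ ≤ n ∧ t - ⌊t / (T / n)⌋₊ * (T / n) ∈ Icc 0 (T / n) := by
  have hn' : (0 : ℝ) < n := Nat.cast_pos.2 hn
  have hτ : 0 < T / n := by positivity
  have h0 : 0 ≤ t / (T / n) := div_nonneg ht.1 hτ.le
  have h1 := Nat.floor_le h0
  have h2 := (Nat.lt_floor_add_one (t / (T / n))).le
  rw [le_div_iff₀ hτ] at h1
  rw [div_le_iff₀ hτ] at h2
  refine ⟨?_, by linarith, by linarith⟩
  refine Nat.floor_le_of_le ?_
  rw [div_le_iff₀ hτ, mul_div_cancel₀ _ hn'.ne']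
  exact ht.2

theorem isTraj_of_hasDerivWithinAt_Icc {E : Type*} [NormedAddCommGroup E]
    [NormedSpace ℝ E] {v : ℝ → E → E} {T : ℝ} {γ : ℝ → E}
    (h : ∀ t ∈ Icc 0 T, HasDerivWithinAt γ (v t (γ t)) (Icc 0 T) t) : IsTraj v T γ := by
  refine ⟨fun t ht => (h t ht).continuousWithinAt, fun s hs => ?_⟩
  exact (h s (Ico_subset_Icc_self hs)).mono_of_mem_nhdsWithin (Icc_mem_nhdsGE_of_mem hs)

variable {E : Type*} [NormedAddCommGroup E] [NormedSpace ℝ E] [CompleteSpace E]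

/-- A field that is continuous in time has global truncated trajectories; they are even
differentiable in the two-sided sense. -/
theorem exists_hasDerivWithinAt_truncField {v : ℝ → E → E} {T : ℝ} (hT : 0 ≤ T)
    (hv : UnifLocLip T v) (hc : ∀ x, ContinuousOn (fun t => v t x) (Icc 0 T)) {R : ℝ} (hR : 0 < R)
    {M : ℝ} (hM0 : 0 ≤ M) (hM : ∀ t ∈ Icc 0 T, ∀ x : E, ‖x‖ ≤ R → ‖v t x‖ ≤ M) (x : E) :
    ∃ γ : ℝ → E, γ 0 = x ∧
      ∀ t ∈ Icc 0 T, HasDerivWithinAt γ (truncField R v t (γ t)) (Icc 0 T) t := by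
  obtain ⟨K, hK⟩ := hv R
  have hpl : IsPicardLindelof (truncField R v) (⟨0, le_rfl, hT⟩ : Icc 0 T) x
      (Real.toNNReal (M * T)) 0 (Real.toNNReal M) (K * 2) :=
    { lipschitzOnWith := fun t ht => (lipschitzWith_truncField hR (hK t ht)).lipschitzOnWith
      continuousOn := fun x _ => hc _
      norm_le := fun t ht x _ => by
        rw [Real.coe_toNNReal _ hM0]
        exact hM t ht _ (norm_ballRetract_le hR x)
      mul_max_le := by
        simp [hT, hM0, mul_nonneg hM0 hT] }
  obtain ⟨γ, h0, h⟩ := hpl.exists_eq_forall_mem_Icc_hasDerivWithinAt₀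
  exact ⟨γ, h0, h⟩

theorem RegularField.of_continuous [MeasurableSpace E] {v : ℝ → E → E} {T : ℝ} (hT : 0 ≤ T)
    (hmeas : Measurable (Function.uncurry v)) (hlip : UnifLocLip T v)
    (hbdd : ∀ R : ℝ, ∃ M : ℝ, 0 < M ∧ ∀ t ∈ Icc 0 T, ∀ x : E, ‖x‖ ≤ R → ‖v t x‖ ≤ M)
    (hc : ∀ x, ContinuousOn (fun t => v t x) (Icc 0 T)) : RegularField T v where
  measurable := hmeas
  lip := hlip
  bdd := hbdd
  exists_traj R hR x := by
    obtain ⟨M, hM0, hM⟩ := hbdd R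
    obtain ⟨γ, h0, h⟩ := exists_hasDerivWithinAt_truncField hT hlip hc hR hM0.le hM x
    exact ⟨γ, h0, isTraj_of_hasDerivWithinAt_Icc h⟩

/-- A field that is piecewise constant in time, with steps of length `T / n`, is regular: the
truncated trajectories of the pieces are concatenated. -/
theorem RegularField.of_steps [MeasurableSpace E] [BorelSpace E] {V : ℕ → E → E} {T : ℝ} {n : ℕ}
    (hT : 0 < T) (hn : 0 < n)
    (hlip : ∀ R : ℝ, ∃ K : NNReal, ∀ k, LipschitzOnWith K (V k) (Metric.closedBall 0 R))
    (hbdd : ∀ R : ℝ, ∃ M : ℝ, 0 < M ∧ ∀ k, ∀ x : E, ‖x‖ ≤ R → ‖V k x‖ ≤ M)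
    (hcont : ∀ k, Continuous (V k)) :
    RegularField T (fun t => V ⌊t / (T / n)⌋₊) := by
  have hn' : (0 : ℝ) < n := Nat.cast_pos.2 hn
  have hh : 0 < T / n := by positivity
  refine ⟨?_, fun R => ?_, fun R => ?_, fun R hR x => ?_⟩
  · have h1 : Measurable (Function.uncurry V) := measurable_from_prod_countable_right
      fun k => (hcont k).measurable
    have h2 : Measurable fun p : ℝ × E => (⌊p.1 / (T / n)⌋₊, p.2) :=
      (Nat.measurable_floor.comp (measurable_fst.div_const _)).prodMk measurable_snd
    exact h1.comp h2
  · obtain ⟨K, hK⟩ := hlip R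
    exact ⟨K, fun t _ => hK _⟩
  · obtain ⟨M, hM0, hM⟩ := hbdd R
    exact ⟨M, hM0, fun t _ => hM _⟩
  · have key : ∀ k : ℕ, ∃ γ : ℝ → E, γ 0 = x ∧
        IsTraj (truncField R (fun t => V ⌊t / (T / n)⌋₊)) (k * (T / n)) γ := by
      intro k
      induction k with
      | zero => exact ⟨fun _ => x, rfl, IsTraj.of_nonpos _ _ (by simp)⟩
      | succ k ih =>
        obtain ⟨γ, h0, hγ⟩ := ih
        obtain ⟨M, hM0, hM⟩ := hbdd R
        obtain ⟨γ', h0', hγ'⟩ := exists_hasDerivWithinAt_truncField (v := fun _ => V k) hh.le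
          (fun R => by
            obtain ⟨K, hK⟩ := hlip R
            exact ⟨K, fun _ _ => hK k⟩) (fun _ => continuousOn_const) hR hM0.le
          (fun _ _ => hM k) (γ (k * (T / n)))
        have h2 := isTraj_of_hasDerivWithinAt_Icc hγ'
        have ha : 0 ≤ k * (T / n) := by positivity
        have h3 := hγ.concat ha (γ' := γ') (b := T / n) (h2.congr_field fun r hr => ?_) h0'
        · refine ⟨_, ?_, by rw [Nat.cast_succ, add_mul, one_mul]; exact h3⟩
          rcases ha.eq_or_lt with h1 | h1
          · simp only [← h1, lt_irrefl, if_false, sub_zero]; rw [h0', ← h1, h0]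
          · simp [h1, h0]
        · simp only [truncField, floor_grid_add hh k hr]
    obtain ⟨γ, h0, hγ⟩ := key n
    rw [mul_div_cancel₀ _ hn'.ne'] at hγ
    exact ⟨γ, h0, hγ⟩

end Existence

section Autonomous

variable {d : ℕ} {w : Phase d → Phase d}

/-- For an autonomous field, `survivors` is the life set: one-sided trajectories are differentiable
in the two-sided sense. -/
theorem survivors_eq_lifeSet {T : ℝ} (hT : 0 ≤ T) (hw : RegularField T (fun _ => w)) :
    survivors w T = lifeSet (fun _ => w) T := by
  ext x
  constructor
  · rintro ⟨γ, h0, h⟩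
    exact ⟨γ, h0, isTraj_of_hasDerivWithinAt_Icc h⟩
  · rintro ⟨γ, h0, h⟩
    obtain ⟨R, hR, hb⟩ := h.exists_norm_le
    obtain ⟨M, hM0, hM⟩ := hw.bdd R
    obtain ⟨γ', h0', h'⟩ := exists_hasDerivWithinAt_truncField hT hw.lip
      (fun _ => continuousOn_const) hR hM0.le hM x
    have heq : EqOn γ γ' (Icc 0 T) := IsTraj.eqOn (hw.lip.trunc hR) le_rfl (h.trunc hR hb)
      (isTraj_of_hasDerivWithinAt_Icc h') (h0.trans h0'.symm)
    refine ⟨γ', h0', fun t ht => ?_⟩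
    have := h' t ht
    rwa [truncField, ballRetract_of_norm_le hR (heq ht ▸ hb t ht)] at this

theorem flow_eq_timeFlow {T : ℝ} (hT : 0 ≤ T) (hw : RegularField T (fun _ => w)) (x : Phase d) :
    flow w T x = timeFlow (fun _ => w) T x := by
  have hS := survivors_eq_lifeSet hT hw
  by_cases h : x ∈ survivors w T
  · rw [flow, dif_pos h]
    obtain ⟨h0, hγ⟩ := h.choose_spec
    have := (isTraj_of_hasDerivWithinAt_Icc (v := fun _ => w) hγ).timeFlow_eq hw.lip hT le_rfl
      le_rfl
    rw [h0] at this
    exact this.symm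
  · rw [flow, dif_neg h, timeFlow_of_notMem (hS ▸ h)]

theorem RegularField.mono_time {E : Type*} [NormedAddCommGroup E] [NormedSpace ℝ E]
    [MeasurableSpace E] {v : ℝ → E → E} {S T : ℝ} (h : RegularField T v) (hST : S ≤ T) :
    RegularField S v where
  measurable := h.measurable
  lip R := by
    obtain ⟨K, hK⟩ := h.lip R
    exact ⟨K, fun t ht => hK t ⟨ht.1, ht.2.trans hST⟩⟩
  bdd R := by
    obtain ⟨M, hM0, hM⟩ := h.bdd R
    exact ⟨M, hM0, fun t ht => hM t ⟨ht.1, ht.2.trans hST⟩⟩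
  exists_traj R hR x := by
    obtain ⟨γ, h0, hγ⟩ := h.exists_traj R hR x
    exact ⟨γ, h0, hγ.mono hST⟩

theorem deficientEvolution_eq_attenuatedTransport {s : ℝ} (hs : 0 ≤ s)
    (hw : RegularField s (fun _ => w)) (ε : ℝ) (μ : Measure (Phase d)) :
    deficientEvolution ε w s μ = attenuatedTransport ε (fun _ => w) s μ := by
  have hflow : flow w s = timeFlow (fun _ => w) s := funext (flow_eq_timeFlow hs hw)
  have hmeas : MeasurableSet (lifeSet (fun _ => w) s) := hw.measurableSet_lifeSet ⟨hs, le_rfl⟩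
  rw [deficientEvolution, attenuatedTransport, hflow, survivors_eq_lifeSet hs hw,
    ← withDensity_indicator hmeas]
  congr 2
  ext x
  by_cases hx : x ∈ lifeSet (fun _ => w) s
  · rw [attenuation, indicator_of_mem hx, indicator_of_mem hx]
    congr 3
    refine intervalIntegral.integral_congr fun r hr => ?_
    rw [uIcc_of_le hs] at hr
    rw [flow_eq_timeFlow hr.1 (hw.mono_time hr.2)]
  · rw [attenuation, indicator_of_notMem hx, indicator_of_notMem hx, ENNReal.ofReal_zero]

end Autonomous

/-! ### No return from beyond a barrier -/

section NoReturn

theorem le_of_rightDeriv_nonneg {f f' : ℝ → ℝ} {a b : ℝ} (hab : a ≤ b)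
    (hf : ContinuousOn f (Icc a b)) (hf' : ∀ s ∈ Ico a b, HasDerivWithinAt f (f' s) (Ici s) s)
    (h0 : ∀ s ∈ Ico a b, 0 ≤ f' s) : f a ≤ f b :=
  image_le_of_deriv_right_le_deriv_boundary (f := fun _ => f a) (f' := fun _ => 0)
    continuousOn_const (fun _ _ => hasDerivWithinAt_const _ _ _) le_rfl hf hf' h0 ⟨hab, le_rfl⟩

theorem rightDeriv_nonneg_of_eventually_le {f : ℝ → ℝ} {f' a : ℝ}
    (hf : HasDerivWithinAt f f' (Ici a) a) (h : ∀ᶠ s in 𝓝[>] a, f a ≤ f s) : 0 ≤ f' := by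
  have h1 := (hasDerivWithinAt_iff_tendsto_slope' self_notMem_Ioi).1 hf.Ioi_of_Ici
  refine ge_of_tendsto h1 ?_
  filter_upwards [h, self_mem_nhdsWithin] with s hs hs'
  rw [slope_def_field]
  exact div_nonneg (sub_nonneg.2 hs) (sub_nonneg.2 (le_of_lt hs'))

/-- The radial barrier argument. If `r'' ≥ δ - u'(r)` with `δ > 0` and `u < u(r(a))` beyond `r(a)`,
then a path `r` that leaves `r(a)` outwards cannot come back: the energy `r'²/2 + u(r)` does not
decrease as long as `r' ≥ 0`, so that `r'` cannot vanish beyond `r(a)`. -/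
theorem false_of_radial_return {u r w acc : ℝ → ℝ} {a b δ : ℝ} (hab : a < b) (hδ : 0 < δ)
    (hu : Differentiable ℝ u) (hu' : Continuous (deriv u))
    (hr : ContinuousOn r (Icc a b)) (hw : ContinuousOn w (Icc a b))
    (hr' : ∀ s ∈ Ico a b, HasDerivWithinAt r (w s) (Ici s) s)
    (hw' : ∀ s ∈ Ico a b, HasDerivWithinAt w (acc s) (Ici s) s)
    (hacc : ∀ s ∈ Ico a b, δ - deriv u (r s) ≤ acc s)
    (hR : ∀ s ∈ Ioo a b, r a < r s) (hb : r b = r a)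
    (hlt : ∀ y, r a < y → u y < u (r a)) : False := by
  have hw0 : 0 ≤ w a := by
    refine rightDeriv_nonneg_of_eventually_le (hr' a ⟨le_rfl, hab⟩) ?_
    filter_upwards [Ioo_mem_nhdsGT hab] with s hs using (hR s hs).le
  have hu0 : deriv u (r a) ≤ 0 := by
    have h1 : HasDerivWithinAt (fun y => -u y) (-deriv u (r a)) (Ici (r a)) (r a) :=
      (hu (r a)).hasDerivAt.neg.hasDerivWithinAt
    have := rightDeriv_nonneg_of_eventually_le h1 (by
      filter_upwards [self_mem_nhdsWithin] with y hy using neg_le_neg (hlt y hy).le)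
    linarith
  have hEr : ContinuousOn (fun s => deriv u (r s)) (Icc a b) := hu'.comp_continuousOn hr
  obtain ⟨c, hac, hcb, hc⟩ : ∃ c, a < c ∧ c < b ∧ ∀ s ∈ Icc a c, deriv u (r s) < δ / 2 := by
    have h1 : ∀ᶠ s in 𝓝[Icc a b] a, deriv u (r s) < δ / 2 :=
      (hEr a ⟨le_rfl, hab.le⟩).eventually_lt_const (by linarith)
    rw [nhdsWithin_Icc_eq_nhdsGE hab] at h1
    obtain ⟨c, hc, hcs⟩ := mem_nhdsGE_iff_exists_Icc_subset.1 h1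
    refine ⟨min c ((a + b) / 2), lt_min hc (by linarith),
      (min_le_right _ _).trans_lt (by linarith),
      fun s hs => hcs ⟨hs.1, hs.2.trans (min_le_left _ _)⟩⟩
  -- on `[a, c]` the acceleration is at least `δ / 2`, so `w` becomes positive at once
  have hwpos : ∀ s ∈ Ioc a c, 0 < w s := by
    intro s hs
    have hsb : s < b := hs.2.trans_lt hcb
    have h1 := le_of_rightDeriv_nonneg (f := fun x => w x - δ / 2 * (x - a))
      (f' := fun x => acc x - δ / 2) hs.1.le
      ((hw.mono (Icc_subset_Icc_right hsb.le)).sub (by fun_prop))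
      (fun x hx => by
        have h2 : HasDerivWithinAt (fun x : ℝ => δ / 2 * (x - a)) (δ / 2) (Ici x) x := by
          simpa using (((hasDerivAt_id x).sub_const a).const_mul (δ / 2)).hasDerivWithinAt
        exact (hw' x ⟨hx.1, hx.2.trans hsb⟩).sub h2)
      (fun x hx => by
        have h3 := hacc x ⟨hx.1, hx.2.trans hsb⟩
        have h4 := hc x ⟨hx.1, hx.2.le.trans hs.2⟩
        linarith)
    simp only [sub_self, mul_zero, sub_zero] at h1
    have : 0 < δ / 2 * (s - a) := mul_pos (by linarith) (by linarith [hs.1])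
    linarith
  -- comparison starts at an interior time, where `r` is already beyond `r a`
  have hmono : ∀ x ∈ Ioc a b, (∀ s ∈ Ico a x, 0 ≤ w s) → r a < r x := by
    intro x hx h
    have hm : (a + x) / 2 ∈ Ioo a b := ⟨by linarith [hx.1], by linarith [hx.1, hx.2]⟩
    refine (hR _ hm).trans_le (le_of_rightDeriv_nonneg (f' := w) (by linarith [hx.1])
      (hr.mono (Icc_subset_Icc hm.1.le hx.2)) (fun s hs => hr' s ?_) (fun s hs => h s ?_))
    · exact ⟨hm.1.le.trans hs.1, hs.2.trans_le hx.2⟩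
    · exact ⟨hm.1.le.trans hs.1, hs.2⟩
  have hne : (Icc c b ∩ w ⁻¹' Iic 0).Nonempty := by
    by_contra hne
    rw [not_nonempty_iff_eq_empty] at hne
    refine (hmono b ⟨hab, le_rfl⟩ fun s hs => ?_).ne hb.symm
    rcases le_or_gt s c with h1 | h1
    · rcases hs.1.eq_or_lt with h2 | h2
      · exact h2 ▸ hw0
      · exact (hwpos s ⟨h2, h1⟩).le
    · by_contra h3
      exact (hne.subset ⟨⟨h1.le, hs.2.le⟩, (not_le.1 h3).le⟩ : s ∈ (∅ : Set ℝ))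
  have hcpt : IsCompact (Icc c b ∩ w ⁻¹' Iic 0) :=
    isCompact_Icc.of_isClosed_subset
      ((hw.mono (Icc_subset_Icc_left hac.le)).preimage_isClosed_of_isClosed isClosed_Icc
        isClosed_Iic) inter_subset_left
  -- `e` is the first turning point after `a`
  obtain ⟨e, ⟨⟨hce, heb⟩, hwe⟩, hmin⟩ := hcpt.exists_isLeast hne
  have hwe0 : w e = 0 := by
    have hwc : 0 < w c := hwpos c ⟨hac, le_rfl⟩
    obtain ⟨x, hx, hwx⟩ := intermediate_value_Icc' hce
      (hw.mono (Icc_subset_Icc hac.le heb)) (⟨hwe, hwc.le⟩ : (0 : ℝ) ∈ Icc (w e) (w c))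
    have : e ≤ x := hmin ⟨⟨hx.1, hx.2.trans heb⟩, hwx.le⟩
    rw [← hwx, le_antisymm hx.2 this]
  have hwnn : ∀ s ∈ Ico a e, 0 ≤ w s := by
    intro s hs
    rcases le_or_gt s c with h1 | h1
    · rcases hs.1.eq_or_lt with h2 | h2
      · exact h2 ▸ hw0
      · exact (hwpos s ⟨h2, h1⟩).le
    · by_contra h3
      exact (not_lt.2 (hmin ⟨⟨h1.le, hs.2.le.trans heb⟩, (not_le.1 h3).le⟩)) hs.2
  have hae : a < e := hac.trans_le hce
  have hre := hmono e ⟨hae, heb⟩ hwnn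
  have hE := le_of_rightDeriv_nonneg (f := fun s => w s ^ 2 / 2 + u (r s))
    (f' := fun s => w s * (acc s + deriv u (r s))) hae.le
    ((((hw.mono (Icc_subset_Icc_right heb)).pow 2).div_const 2).add
      (hu.continuous.comp_continuousOn (hr.mono (Icc_subset_Icc_right heb))))
    (fun s hs => by
      have hs' : s ∈ Ico a b := ⟨hs.1, hs.2.trans_le heb⟩
      have h1 := ((hw' s hs').pow 2).div_const 2
      have h2 := (hu (r s)).hasDerivAt.comp_hasDerivWithinAt s (hr' s hs')
      refine (h1.add h2).congr_deriv ?_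
      simp; ring)
    (fun s hs => mul_nonneg (hwnn s hs) (by
      have := hacc s ⟨hs.1, hs.2.trans_le heb⟩
      linarith))
  simp only [hwe0] at hE
  have := hlt _ hre
  nlinarith [sq_nonneg (w a)]

variable {V : Type*} [NormedAddCommGroup V] [InnerProductSpace ℝ V]

/-- A particle whose radial force is at least `δ - u'(|q|)` and whose position lies in the ball of
radius `R` at the times `0` and `t` has not left this ball in between, if `u < u(R)` beyond `R`. -/
theorem norm_le_of_norm_endpoints_le {u : ℝ → ℝ} {q p f : ℝ → V} {t δ R : ℝ} (hδ : 0 < δ)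
    (hR0 : 0 < R) (hu : Differentiable ℝ u) (hu' : Continuous (deriv u))
    (hq : ContinuousOn q (Icc 0 t)) (hp : ContinuousOn p (Icc 0 t))
    (hq' : ∀ s ∈ Ico 0 t, HasDerivWithinAt q (p s) (Ici s) s)
    (hp' : ∀ s ∈ Ico 0 t, HasDerivWithinAt p (f s) (Ici s) s)
    (hf : ∀ s ∈ Ico 0 t, q s ≠ 0 → (δ - deriv u ‖q s‖) * ‖q s‖ ≤ inner ℝ (q s) (f s))
    (hlt : ∀ y, R < y → u y < u R) (h0 : ‖q 0‖ ≤ R) (ht : ‖q t‖ ≤ R) :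
    ∀ s ∈ Icc 0 t, ‖q s‖ ≤ R := by
  intro s₁ hs₁
  by_contra! hlarge
  have hcont := hq.norm
  -- `a` is the last time in the ball before `s₁`, and `b` the first one after `s₁`
  have hcpt1 : IsCompact (Icc 0 s₁ ∩ (fun s => ‖q s‖) ⁻¹' Iic R) :=
    isCompact_Icc.of_isClosed_subset ((hcont.mono
      (Icc_subset_Icc_right hs₁.2)).preimage_isClosed_of_isClosed isClosed_Icc isClosed_Iic)
      inter_subset_left
  have hcpt2 : IsCompact (Icc s₁ t ∩ (fun s => ‖q s‖) ⁻¹' Iic R) :=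
    isCompact_Icc.of_isClosed_subset ((hcont.mono
      (Icc_subset_Icc_left hs₁.1)).preimage_isClosed_of_isClosed isClosed_Icc isClosed_Iic)
      inter_subset_left
  obtain ⟨a, ⟨⟨ha0, has⟩, haR⟩, hamax⟩ := hcpt1.exists_isGreatest ⟨0, ⟨le_rfl, hs₁.1⟩, h0⟩
  obtain ⟨b, ⟨⟨hsb, hbt⟩, hbR⟩, hbmin⟩ := hcpt2.exists_isLeast ⟨t, ⟨hs₁.2, le_rfl⟩, ht⟩
  have haR' : ‖q a‖ = R := by
    obtain ⟨x, hx, hxR⟩ := intermediate_value_Icc has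
      (hcont.mono (Icc_subset_Icc ha0 hs₁.2)) (⟨haR, hlarge.le⟩ : R ∈ Icc ‖q a‖ ‖q s₁‖)
    have : x ≤ a := hamax ⟨⟨ha0.trans hx.1, hx.2⟩, (show ‖q x‖ = R from hxR).le⟩
    rw [← le_antisymm this hx.1]; exact hxR
  have hbR' : ‖q b‖ = R := by
    obtain ⟨x, hx, hxR⟩ := intermediate_value_Icc' hsb
      (hcont.mono (Icc_subset_Icc hs₁.1 hbt)) (⟨hbR, hlarge.le⟩ : R ∈ Icc ‖q b‖ ‖q s₁‖)
    have : b ≤ x := hbmin ⟨⟨hx.1, hx.2.trans hbt⟩, (show ‖q x‖ = R from hxR).le⟩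
    rw [← le_antisymm hx.2 this]; exact hxR
  have hbig : ∀ s ∈ Ioo a b, R < ‖q s‖ := by
    intro s hs
    by_contra! h
    rcases le_total s s₁ with h1 | h1
    · exact (not_lt.2 (hamax ⟨⟨ha0.trans hs.1.le, h1⟩, h⟩)) hs.1
    · exact (not_lt.2 (hbmin ⟨⟨h1, hs.2.le.trans hbt⟩, h⟩)) hs.2
  have hab : a < b := by
    rcases has.eq_or_lt with h1 | h1
    · exact absurd haR' (by rw [h1]; exact hlarge.ne')
    · exact h1.trans_le hsb
  have hge : ∀ s ∈ Icc a b, R ≤ ‖q s‖ := by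
    intro s hs
    rcases hs.1.eq_or_lt with h1 | h1
    · exact (h1 ▸ haR').ge
    rcases hs.2.eq_or_lt with h2 | h2
    · exact (h2 ▸ hbR').ge
    · exact (hbig s ⟨h1, h2⟩).le
  have hpos : ∀ s ∈ Icc a b, 0 < ‖q s‖ := fun s hs => hR0.trans_le (hge s hs)
  have hsub : Icc a b ⊆ Icc 0 t := Icc_subset_Icc ha0 hbt
  have hsub' : Ico a b ⊆ Ico 0 t := fun s hs => ⟨ha0.trans hs.1, hs.2.trans_le hbt⟩
  have hr' : ∀ s ∈ Ico a b,
      HasDerivWithinAt (fun s => ‖q s‖) (inner ℝ (q s) (p s) / ‖q s‖) (Ici s) s := by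
    intro s hs
    have hqs := hpos s (Ico_subset_Icc_self hs)
    have h1 := (hq' s (hsub' hs)).norm_sq.sqrt (by simpa using hqs.ne')
    simp only [Real.sqrt_sq (norm_nonneg _)] at h1
    refine h1.congr_deriv ?_
    field_simp
  refine false_of_radial_return (r := fun s => ‖q s‖)
    (w := fun s => inner ℝ (q s) (p s) / ‖q s‖)
    (acc := fun s => ((inner ℝ (q s) (f s) + inner ℝ (p s) (p s)) * ‖q s‖
      - inner ℝ (q s) (p s) * (inner ℝ (q s) (p s) / ‖q s‖)) / ‖q s‖ ^ 2)
    hab hδ hu hu' (hcont.mono hsub)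
    (((hq.inner hp).mono hsub).div (hcont.mono hsub) fun s hs => (hpos s hs).ne') hr' ?_ ?_
    (fun s hs => by rw [haR']; exact hbig s hs) (by rw [hbR', haR'])
    (by rw [haR']; exact hlt)
  · intro s hs
    exact ((hq' s (hsub' hs)).inner ℝ (hp' s (hsub' hs))).div (hr' s hs)
      (hpos s (Ico_subset_Icc_self hs)).ne'
  · intro s hs
    have hqs := hpos s (Ico_subset_Icc_self hs)
    have h1 := hf s (hsub' hs) (norm_pos_iff.1 hqs)
    have h2 : inner ℝ (q s) (p s) * (inner ℝ (q s) (p s) / ‖q s‖)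
        ≤ inner ℝ (p s) (p s) * ‖q s‖ := by
      rw [mul_div_assoc', div_le_iff₀ hqs, real_inner_self_eq_norm_sq]
      have := abs_real_inner_le_norm (q s) (p s)
      have h3 : inner ℝ (q s) (p s) * inner ℝ (q s) (p s) ≤ (‖q s‖ * ‖p s‖) ^ 2 := by
        rw [← pow_two, ← sq_abs]
        gcongr
      nlinarith
    rw [le_div_iff₀ (by positivity)]
    nlinarith

end NoReturn

/-! ### Hamiltonian force fields and confinement -/

section ForceField

variable {d : ℕ}

/-- The phase space field `(p, q) ↦ (-(g(t, q) + ∇Φ(q)), p)` with the interaction force `-g`. -/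
noncomputable def forceField (Φ : Space d → ℝ) (g : ℝ → Space d → Space d) (t : ℝ)
    (x : Phase d) : Phase d :=
  WithLp.toLp 2 (-(g t x.snd + gradient Φ x.snd), x.fst)

/-- A trajectory of a force bounded by `b` that starts in the ball of radius `P` and ends over
positions of norm at most `R` stays in a ball whose radius depends on `P` and `R` only. -/
def Confining (Φ : Space d → ℝ) (b T : ℝ) : Prop :=
  ∀ P R : ℝ, ∃ ρ : ℝ, 0 < ρ ∧ ∀ g : ℝ → Space d → Space d,
    (∀ t ∈ Icc 0 T, ∀ q, ‖g t q‖ ≤ b) → ∀ t ∈ Icc 0 T, ∀ γ : ℝ → Phase d,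
      IsTraj (forceField Φ g) t γ → ‖γ 0‖ ≤ P → ‖(γ t).snd‖ ≤ R → ∀ s ∈ Icc 0 t, ‖γ s‖ ≤ ρ

theorem continuous_gradient {f : Space d → ℝ} (hf : ContDiff ℝ 2 f) : Continuous (gradient f) := by
  unfold gradient
  exact (LinearIsometryEquiv.continuous _).comp (hf.continuous_fderiv (by norm_num))

theorem norm_phase_le (x : Phase d) : ‖x‖ ≤ ‖x.fst‖ + ‖x.snd‖ := by
  rw [WithLp.prod_norm_eq_of_L2]
  exact Real.sqrt_le_iff.2 ⟨by positivity, by nlinarith [norm_nonneg x.fst, norm_nonneg x.snd]⟩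

/-- Barriers at arbitrarily large radii confine: the position cannot have left the ball of a
barrier, and inside this ball the force, hence the momentum, is bounded. -/
theorem confining_of_barriers {Φ : Space d → ℝ} (hΦ : ContDiff ℝ 2 Φ) {B b T : ℝ} {u : ℝ → ℝ}
    {qstar : ℕ → Space d} (hb0 : 0 ≤ b) (hbB : b < B) (hu : ContDiff ℝ 2 u)
    (hΦu : ∀ q : Space d, q ≠ 0 → B + inner ℝ (gradient Φ q) (‖q‖⁻¹ • q) ≤ deriv u ‖q‖)
    (hlim : Tendsto (fun L => ‖qstar L‖) atTop atTop)
    (hlt : ∀ (L : ℕ) (q : Space d), ‖qstar L‖ < ‖q‖ → u ‖q‖ < u ‖qstar L‖) :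
    Confining Φ b T := by
  intro P R
  -- a barrier outside both balls; the momentum grows at most at the rate `b + C` inside it
  obtain ⟨L, hL⟩ := (hlim.eventually_ge_atTop (max 1 (max P R))).exists
  set r := ‖qstar L‖ with hr
  have hr1 : 1 ≤ r := (le_max_left _ _).trans hL
  have hPr : P ≤ r := ((le_max_left _ _).trans (le_max_right _ _)).trans hL
  have hRr : R ≤ r := ((le_max_right _ _).trans (le_max_right _ _)).trans hL
  obtain ⟨C, hC⟩ := (isCompact_closedBall (0 : Space d) r).exists_bound_of_continuousOn
    (continuous_gradient hΦ).continuousOn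
  have hC0 : 0 ≤ C := (norm_nonneg _).trans (hC 0 (by simp; linarith))
  refine ⟨|P| + (b + C) * |T| + r, by positivity, fun g hg t ht γ hγ h0 hend => ?_⟩
  have hqc : ContinuousOn (fun s => (γ s).snd) (Icc 0 t) :=
    (WithLp.sndL 2 ℝ (Space d) (Space d)).continuous.comp_continuousOn hγ.1
  have hpc : ContinuousOn (fun s => (γ s).fst) (Icc 0 t) :=
    (WithLp.fstL 2 ℝ (Space d) (Space d)).continuous.comp_continuousOn hγ.1
  have hq' : ∀ s ∈ Ico 0 t, HasDerivWithinAt (fun s => (γ s).snd) ((γ s).fst) (Ici s) s :=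
    fun s hs => (WithLp.sndL 2 ℝ (Space d) (Space d)).hasFDerivAt.comp_hasDerivWithinAt s
      (hγ.2 s hs)
  have hp' : ∀ s ∈ Ico 0 t, HasDerivWithinAt (fun s => (γ s).fst)
      (-(g s (γ s).snd + gradient Φ (γ s).snd)) (Ici s) s :=
    fun s hs => (WithLp.fstL 2 ℝ (Space d) (Space d)).hasFDerivAt.comp_hasDerivWithinAt s
      (hγ.2 s hs)
  -- a point of norm `y` for each `y > r`, to read the barrier condition radially
  have hlt' : ∀ y, r < y → u y < u r := by
    intro y hy
    have hq0 : qstar L ≠ 0 := by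
      rw [← norm_pos_iff]; linarith
    have hn : ‖(y / r) • qstar L‖ = y := by
      rw [norm_smul, Real.norm_of_nonneg (div_nonneg (by linarith) (by linarith)), ← hr,
        div_mul_cancel₀ _ (by linarith)]
    have := hlt L ((y / r) • qstar L) (by rw [hn]; exact hy)
    rwa [hn] at this
  have hpos := norm_le_of_norm_endpoints_le (u := u) (δ := B - b) (R := r) (by linarith)
    (by linarith) (hu.differentiable (by norm_num)) (hu.continuous_deriv (by norm_num))
    hqc hpc hq' hp' (fun s hs hne => ?_) hlt'
    ((WithLp.norm_snd_le _ _).trans (h0.trans hPr)) (hend.trans hRr)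
  · intro s hs
    have hp := norm_image_sub_le_of_norm_deriv_right_le_segment (C := b + C)
      (hpc.mono (Icc_subset_Icc_right hs.2)) (fun r hr => hp' r ⟨hr.1, hr.2.trans_le hs.2⟩)
      (fun r hr => by
        rw [norm_neg]
        refine (norm_add_le _ _).trans (add_le_add (hg r ⟨hr.1, by linarith [hr.2, hs.2, ht.2]⟩ _)
          (hC _ ?_))
        simpa using hpos r ⟨hr.1, hr.2.le.trans hs.2⟩) s ⟨hs.1, le_rfl⟩
    have h1 : ‖(γ s).fst‖ ≤ |P| + (b + C) * |T| := by
      have h2 : ‖(γ 0).fst‖ ≤ |P| := (WithLp.norm_fst_le _ _).trans (h0.trans (le_abs_self _))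
      have h3 := norm_le_norm_add_norm_sub' ((γ s).fst) ((γ 0).fst)
      have h4 : (b + C) * (s - 0) ≤ (b + C) * |T| := by
        have : s - 0 ≤ |T| := by rw [sub_zero]; exact (hs.2.trans ht.2).trans (le_abs_self _)
        gcongr
      linarith
    linarith [norm_phase_le (γ s), hpos s hs]
  · set q := (γ s).snd
    have hsT : s ∈ Icc 0 T := ⟨hs.1, hs.2.le.trans ht.2⟩
    have hqn : 0 < ‖q‖ := norm_pos_iff.2 hne
    have h1 := hΦu q hne
    rw [real_inner_smul_right, real_inner_comm] at h1
    have h2 : inner ℝ q (g s q) ≤ ‖q‖ * b :=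
      (real_inner_le_norm _ _).trans (mul_le_mul_of_nonneg_left (hg s hsT q) hqn.le)
    have h3 : inner ℝ q (gradient Φ q) ≤ (deriv u ‖q‖ - B) * ‖q‖ := by
      rw [← div_le_iff₀ hqn, div_eq_inv_mul]; linarith
    rw [inner_neg_right, inner_add_right]
    nlinarith

end ForceField

/-! ### Equicontinuity in time -/

section Equicontinuity

variable {d : ℕ} {Φ : Space d → ℝ} {b T : ℝ}

theorem exists_norm_forceField_le (hΦ : ContDiff ℝ 2 Φ) (hb : 0 ≤ b) (T R : ℝ) :
    ∃ M : ℝ, 0 < M ∧ ∀ g : ℝ → Space d → Space d, (∀ t ∈ Icc 0 T, ∀ q, ‖g t q‖ ≤ b) →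
      ∀ t ∈ Icc 0 T, ∀ x : Phase d, ‖x‖ ≤ R → ‖forceField Φ g t x‖ ≤ M := by
  obtain ⟨C, hC⟩ := (isCompact_closedBall (0 : Space d) R).exists_bound_of_continuousOn
    (continuous_gradient hΦ).continuousOn
  refine ⟨b + |C| + |R| + 1, by positivity, fun g hg t ht x hx => ?_⟩
  have h1 := norm_phase_le (forceField Φ g t x)
  simp only [forceField, WithLp.toLp_fst, WithLp.toLp_snd, norm_neg] at h1
  have h2 := norm_add_le (g t x.snd) (gradient Φ x.snd)
  have h3 := hg t ht x.snd
  have h4 := hC x.snd (by simpa using (WithLp.norm_snd_le _ _).trans hx)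
  have h5 : ‖x.fst‖ ≤ |R| := (WithLp.norm_fst_le _ _).trans (hx.trans (le_abs_self _))
  rw [forceField]
  linarith [le_abs_self C]

/-- A trajectory that is over the ball of radius `R` at one of two close times exists up to the
later time and is confined to a fixed ball. -/
theorem exists_confined_of_close_times (hΦ : ContDiff ℝ 2 Φ) (hb : 0 ≤ b)
    (hconf : Confining Φ b T) (P R : ℝ) :
    ∃ ρ η : ℝ, 0 < ρ ∧ 0 < η ∧ ∀ g : ℝ → Space d → Space d,
      (∀ t ∈ Icc 0 T, ∀ q, ‖g t q‖ ≤ b) → RegularField T (forceField Φ g) →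
      ∀ x : Phase d, ‖x‖ ≤ P → ∀ s t : ℝ, 0 ≤ s → s ≤ t → t ≤ T → t - s ≤ η →
      ((x ∈ lifeSet (forceField Φ g) s ∧ ‖(timeFlow (forceField Φ g) s x).snd‖ ≤ R) ∨
        (x ∈ lifeSet (forceField Φ g) t ∧ ‖(timeFlow (forceField Φ g) t x).snd‖ ≤ R)) →
      x ∈ lifeSet (forceField Φ g) t ∧
        ∀ r ∈ Icc 0 t, ‖timeFlow (forceField Φ g) r x‖ ≤ ρ := by
  obtain ⟨ρ, hρ, hcon⟩ := hconf P R
  obtain ⟨M, hM0, hM⟩ := exists_norm_forceField_le hΦ hb T (ρ + 1)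
  -- leaving the ball of radius `ρ + 1` from the ball of radius `ρ` takes at least the time `1 / M`
  refine ⟨ρ + 1, 1 / M, by positivity, by positivity,
    fun g hg hv x hx s t hs hst htT hη hor => ?_⟩
  have hin : ∀ τ, 0 ≤ τ → τ ≤ T → x ∈ lifeSet (forceField Φ g) τ →
      ‖(timeFlow (forceField Φ g) τ x).snd‖ ≤ R →
      ∀ r ∈ Icc 0 τ, ‖timeFlow (forceField Φ g) r x‖ ≤ ρ := fun τ h0 hτ hmem hend =>
    hcon g hg τ ⟨h0, hτ⟩ _ (isTraj_timeFlow hv.lip hτ hmem) (by rwa [timeFlow_zero]) hend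
  rcases hor with ⟨hmem, hend⟩ | ⟨hmem, hend⟩
  · have h1 := hin s hs (hst.trans htT) hmem hend
    have hρ1 : 0 < ρ + 1 := by positivity
    have heq := hv.truncFlow_eq' hρ1 (hst.trans htT) hmem fun r hr =>
      (h1 r hr).trans (by linarith)
    have hball : ∀ r ∈ Icc 0 t, ‖timeFlow (truncField (ρ + 1) (forceField Φ g)) r x‖ ≤ ρ + 1 := by
      intro r hr
      rcases le_total r s with h | h
      · rw [heq r ⟨hr.1, h⟩]
        exact (h1 r ⟨hr.1, h⟩).trans (by linarith)
      · have h2 := (hv.isTraj_truncFlow hρ1 x).norm_sub_le (M := M) hs h (hr.2.trans htT)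
          (fun τ hτ => hM g hg τ ⟨hs.trans hτ.1, by linarith [hτ.2, hr.2]⟩ _
            (norm_ballRetract_le hρ1 _))
        have h3 := norm_le_norm_add_norm_sub'
          (timeFlow (truncField (ρ + 1) (forceField Φ g)) r x)
          (timeFlow (truncField (ρ + 1) (forceField Φ g)) s x)
        have h4 : ‖timeFlow (truncField (ρ + 1) (forceField Φ g)) s x‖ ≤ ρ := by
          rw [heq s ⟨hs, le_rfl⟩]; exact h1 s ⟨hs, le_rfl⟩
        have h5 : M * (r - s) ≤ 1 := by
          rw [le_div_iff₀ hM0] at hη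
          nlinarith [hr.2]
        linarith
    obtain ⟨h2, h3⟩ := hv.truncFlow_eq hρ1 htT hball
    exact ⟨h2, fun r hr => by rw [h3 r hr]; exact hball r hr⟩
  · exact ⟨hmem, fun r hr =>
      (hin t (hs.trans hst) htT hmem hend r hr).trans (by linarith)⟩

theorem abs_exp_neg_sub_exp_neg_le {a c : ℝ} (ha : 0 ≤ a) (hac : a ≤ c) :
    |Real.exp (-c) - Real.exp (-a)| ≤ c - a := by
  have h1 : Real.exp (-c) ≤ Real.exp (-a) := Real.exp_le_exp.2 (by linarith)
  rw [abs_of_nonpos (by linarith)]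
  have h2 : Real.exp (-c) = Real.exp (-a) * Real.exp (-(c - a)) := by
    rw [← Real.exp_add]; ring_nf
  have h3 := Real.add_one_le_exp (-(c - a))
  have h4 : Real.exp (-a) ≤ 1 := Real.exp_le_one_iff.2 (by linarith)
  have h5 := Real.exp_pos (-a)
  rw [h2]
  nlinarith

variable {F : Type*} [NormedAddCommGroup F] [NormedSpace ℝ F]

theorem attenuated_eq_zero {v : ℝ → Phase d → Phase d} {ψ : Phase d → F} {R t : ℝ} {x : Phase d}
    (hψ0 : ∀ y, R < ‖y.snd‖ → ψ y = 0)
    (h : ¬ (x ∈ lifeSet v t ∧ ‖(timeFlow v t x).snd‖ ≤ R)) (ε : ℝ) :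
    attenuation ε v t x • ψ (timeFlow v t x) = 0 := by
  by_cases hx : x ∈ lifeSet v t
  · rw [hψ0 _ (not_le.1 fun h' => h ⟨hx, h'⟩), smul_zero]
  · rw [attenuation, indicator_of_notMem hx, zero_smul]

/-- Observables supported over a ball of positions are Lipschitz in time along the trajectories,
uniformly in the force, the attenuation and the starting point in a ball. -/
theorem exists_lipschitz_attenuated (hΦ : ContDiff ℝ 2 Φ) (hb : 0 ≤ b)
    (hconf : Confining Φ b T) (P R : ℝ) (K : NNReal) {C : ℝ} (hC : 0 ≤ C) :
    ∃ L η : ℝ, 0 ≤ L ∧ 0 < η ∧ ∀ g : ℝ → Space d → Space d,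
      (∀ t ∈ Icc 0 T, ∀ q, ‖g t q‖ ≤ b) → RegularField T (forceField Φ g) →
      ∀ ψ : Phase d → F, LipschitzWith K ψ → (∀ y, ‖ψ y‖ ≤ C) → (∀ y, R < ‖y.snd‖ → ψ y = 0) →
      ∀ ε ∈ Icc (0 : ℝ) 1, ∀ x : Phase d, ‖x‖ ≤ P → ∀ s t : ℝ, 0 ≤ s → s ≤ t → t ≤ T →
      t - s ≤ η →
      ‖attenuation ε (forceField Φ g) t x • ψ (timeFlow (forceField Φ g) t x)
        - attenuation ε (forceField Φ g) s x • ψ (timeFlow (forceField Φ g) s x)‖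
        ≤ L * (t - s) := by
  obtain ⟨ρ, η, hρ, hη, hclose⟩ := exists_confined_of_close_times hΦ hb hconf P R
  obtain ⟨M, hM0, hM⟩ := exists_norm_forceField_le hΦ hb T ρ
  refine ⟨M * C + K * M, η, by positivity, hη,
    fun g hg hv ψ hψ hψC hψ0 ε hε x hx s t hs hst htT hts => ?_⟩
  set v := forceField Φ g with hvdef
  by_cases hor : (x ∈ lifeSet v s ∧ ‖(timeFlow v s x).snd‖ ≤ R) ∨
        (x ∈ lifeSet v t ∧ ‖(timeFlow v t x).snd‖ ≤ R)
  · obtain ⟨hmem, hball⟩ := hclose g hg hv x hx s t hs hst htT hts hor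
    have hspeed : ∀ r ∈ Icc 0 t, ‖v r (timeFlow v r x)‖ ≤ M := fun r hr =>
      hM g hg r ⟨hr.1, hr.2.trans htT⟩ _ (hball r hr)
    have h1 : ‖timeFlow v t x - timeFlow v s x‖ ≤ M * (t - s) :=
      (isTraj_timeFlow hv.lip htT hmem).norm_sub_le hs hst le_rfl fun r hr =>
        hspeed r ⟨hs.trans hr.1, hr.2.le⟩
    have htIcc : t ∈ Icc 0 T := ⟨hs.trans hst, htT⟩
    have hint := fun a b (ha : a ∈ Icc 0 t) (hb : b ∈ Icc 0 t) =>
      hv.intervalIntegrable_speed htIcc hmem ε ha hb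
    have hsplit := intervalIntegral.integral_add_adjacent_intervals
      (hint 0 s ⟨le_rfl, htIcc.1⟩ ⟨hs, hst⟩) (hint s t ⟨hs, hst⟩ ⟨htIcc.1, le_rfl⟩)
    have hA0 : 0 ≤ ∫ r in (0 : ℝ)..s, ε * ‖v r (timeFlow v r x)‖ :=
      intervalIntegral.integral_nonneg hs fun r _ => mul_nonneg hε.1 (norm_nonneg _)
    have hA1 : 0 ≤ ∫ r in s..t, ε * ‖v r (timeFlow v r x)‖ :=
      intervalIntegral.integral_nonneg hst fun r _ => mul_nonneg hε.1 (norm_nonneg _)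
    have hA2 : ∫ r in s..t, ε * ‖v r (timeFlow v r x)‖ ≤ M * (t - s) := by
      have := intervalIntegral.integral_mono_on hst (hint s t ⟨hs, hst⟩ ⟨htIcc.1, le_rfl⟩)
        (intervalIntegrable_const (c := M)) (fun r hr => by
          have h2 := hspeed r ⟨hs.trans hr.1, hr.2⟩
          have h3 : ε * ‖v r (timeFlow v r x)‖ ≤ 1 * ‖v r (timeFlow v r x)‖ := by
            gcongr; exact hε.2
          linarith)
      rwa [intervalIntegral.integral_const, smul_eq_mul, mul_comm] at this
    have hatt : |attenuation ε v t x - attenuation ε v s x| ≤ M * (t - s) := by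
      rw [attenuation, attenuation, indicator_of_mem hmem,
        indicator_of_mem (lifeSet_anti v hst hmem)]
      refine (abs_exp_neg_sub_exp_neg_le hA0 ?_).trans ?_ <;> linarith
    have hdec : attenuation ε v t x • ψ (timeFlow v t x)
        - attenuation ε v s x • ψ (timeFlow v s x)
        = (attenuation ε v t x - attenuation ε v s x) • ψ (timeFlow v t x)
          + attenuation ε v s x • (ψ (timeFlow v t x) - ψ (timeFlow v s x)) := by
      rw [sub_smul, smul_sub]; abel
    have h5 : ‖ψ (timeFlow v t x) - ψ (timeFlow v s x)‖ ≤ K * (M * (t - s)) := by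
      rw [← dist_eq_norm]
      refine (hψ.dist_le_mul _ _).trans ?_
      rw [dist_eq_norm]
      gcongr
    rw [hdec]
    calc _ ≤ M * (t - s) * C + 1 * (K * (M * (t - s))) := by
          refine (norm_add_le _ _).trans (add_le_add ?_ ?_)
          · rw [norm_smul, Real.norm_eq_abs]
            exact mul_le_mul hatt (hψC _) (norm_nonneg _)
              (mul_nonneg hM0.le (sub_nonneg.2 hst))
          · rw [norm_smul, Real.norm_of_nonneg (attenuation_nonneg _ _ _ _)]
            exact mul_le_mul (attenuation_le_one hε.1 v hs x) h5 (norm_nonneg _) zero_le_one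
      _ = (M * C + K * M) * (t - s) := by ring
  · rw [not_or] at hor
    rw [attenuated_eq_zero hψ0 hor.2, attenuated_eq_zero hψ0 hor.1, sub_zero, norm_zero]
    exact mul_nonneg (by positivity) (sub_nonneg.2 hst)

theorem exists_measureReal_norm_gt_le (μ : Measure (Phase d)) [IsFiniteMeasure μ] {δ : ℝ}
    (hδ : 0 < δ) : ∃ P : ℝ, μ.real {x | P < ‖x‖} ≤ δ := by
  have h : Tendsto (fun n : ℕ => μ {x | (n : ℝ) < ‖x‖}) atTop
      (𝓝 (μ (⋂ n : ℕ, {x | (n : ℝ) < ‖x‖}))) :=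
    tendsto_measure_iInter_atTop
      (fun n => (measurableSet_lt measurable_const measurable_norm).nullMeasurableSet)
      (fun m n hmn x hx =>
        show (m : ℝ) < ‖x‖ from (Nat.cast_le.2 hmn).trans_lt (show (n : ℝ) < ‖x‖ from hx))
      ⟨0, measure_ne_top _ _⟩
  have he : (⋂ n : ℕ, {x : Phase d | (n : ℝ) < ‖x‖}) = ∅ := by
    refine eq_empty_of_forall_notMem fun x hx => ?_
    obtain ⟨n, hn⟩ := exists_nat_ge ‖x‖
    exact absurd (mem_iInter.1 hx n) (not_lt.2 hn)
  rw [he, measure_empty] at h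
  obtain ⟨n, hn⟩ := (h.eventually_le_const (ENNReal.ofReal_pos.2 hδ)).exists
  exact ⟨n, ENNReal.toReal_le_of_le_ofReal hδ.le hn⟩

theorem integrable_attenuated {v : ℝ → Phase d → Phase d} (hv : RegularField T v)
    {μ : Measure (Phase d)} [IsFiniteMeasure μ] {ψ : Phase d → F} (hψ : Continuous ψ) {C : ℝ}
    (hψC : ∀ y, ‖ψ y‖ ≤ C) {ε : ℝ} (hε : 0 ≤ ε) {t : ℝ} (ht : t ∈ Icc 0 T) :
    Integrable (fun x => attenuation ε v t x • ψ (timeFlow v t x)) μ := by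
  refine Integrable.of_bound (C := C) ?_ (Eventually.of_forall fun x => ?_)
  · exact ((hv.measurable_attenuation ε ht).stronglyMeasurable.smul
      (hψ.stronglyMeasurable.comp_measurable (hv.measurable_timeFlow ht))).aestronglyMeasurable
  · rw [norm_smul, Real.norm_of_nonneg (attenuation_nonneg _ _ _ _)]
    calc _ ≤ 1 * C := mul_le_mul (attenuation_le_one hε v ht.1 x) (hψC _) (norm_nonneg _)
          zero_le_one
      _ = C := one_mul C

/-- Equicontinuity in time of the integrals of observables supported over a ball of positions,
uniformly in the force and in the attenuation. -/
theorem exists_equicontinuous_integral (hΦ : ContDiff ℝ 2 Φ) (hb : 0 ≤ b)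
    (hconf : Confining Φ b T) (μ : Measure (Phase d)) [IsProbabilityMeasure μ] (R : ℝ) (K : NNReal)
    {C : ℝ} (hC : 0 ≤ C) {δ : ℝ} (hδ : 0 < δ) :
    ∃ η : ℝ, 0 < η ∧ ∀ g : ℝ → Space d → Space d,
      (∀ t ∈ Icc 0 T, ∀ q, ‖g t q‖ ≤ b) → RegularField T (forceField Φ g) →
      ∀ ψ : Phase d → F, LipschitzWith K ψ → (∀ y, ‖ψ y‖ ≤ C) → (∀ y, R < ‖y.snd‖ → ψ y = 0) →
      ∀ ε ∈ Icc (0 : ℝ) 1, ∀ s ∈ Icc 0 T, ∀ t ∈ Icc 0 T, |t - s| ≤ η →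
      ‖∫ y, ψ y ∂(attenuatedTransport ε (forceField Φ g) t μ)
        - ∫ y, ψ y ∂(attenuatedTransport ε (forceField Φ g) s μ)‖ ≤ δ := by
  -- outside the ball of radius `P` the difference is only bounded by `2 * C`
  obtain ⟨P, hP⟩ := exists_measureReal_norm_gt_le μ (δ := δ / (2 * (2 * C + 1))) (by positivity)
  obtain ⟨L, η, hL, hη, hlip⟩ := exists_lipschitz_attenuated (F := F) hΦ hb hconf P R K hC
  refine ⟨min η (δ / (2 * (L + 1))), by positivity, ?_⟩
  intro g hg hv ψ hψ hψC hψ0 ε hε s hs t ht hst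
  wlog hle : s ≤ t generalizing s t
  · rw [norm_sub_rev]
    exact this t ht s hs (by rwa [abs_sub_comm]) (le_of_not_ge hle)
  have hst1 : t - s ≤ η := (le_abs_self _).trans (hst.trans (min_le_left _ _))
  have hst2 : t - s ≤ δ / (2 * (L + 1)) := (le_abs_self _).trans (hst.trans (min_le_right _ _))
  rw [hv.integral_attenuatedTransport ε ht μ hψ.continuous.stronglyMeasurable,
    hv.integral_attenuatedTransport ε hs μ hψ.continuous.stronglyMeasurable,
    ← integral_sub (integrable_attenuated hv hψ.continuous hψC hε.1 ht)
      (integrable_attenuated hv hψ.continuous hψC hε.1 hs)]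
  have hmeas : MeasurableSet {x : Phase d | P < ‖x‖} :=
    measurableSet_lt measurable_const measurable_norm
  have hbound : ∀ x, ‖attenuation ε (forceField Φ g) t x • ψ (timeFlow (forceField Φ g) t x)
        - attenuation ε (forceField Φ g) s x • ψ (timeFlow (forceField Φ g) s x)‖
      ≤ δ / 2 + {x : Phase d | P < ‖x‖}.indicator (fun _ => 2 * C) x := by
    intro x
    by_cases hx : P < ‖x‖
    · rw [indicator_of_mem (by exact hx)]
      have h1 : ∀ τ ∈ Icc 0 T, ‖attenuation ε (forceField Φ g) τ x •
          ψ (timeFlow (forceField Φ g) τ x)‖ ≤ C := fun τ hτ => by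
        rw [norm_smul, Real.norm_of_nonneg (attenuation_nonneg _ _ _ _)]
        calc _ ≤ 1 * C := mul_le_mul (attenuation_le_one hε.1 _ hτ.1 x) (hψC _) (norm_nonneg _)
              zero_le_one
          _ = C := one_mul C
      refine (norm_sub_le _ _).trans ?_
      linarith [h1 t ht, h1 s hs]
    · rw [indicator_of_notMem (by exact hx), add_zero]
      refine (hlip g hg hv ψ hψ hψC hψ0 ε hε x (not_lt.1 hx) s t hs.1 hle ht.2 hst1).trans ?_
      have h2 : L * (t - s) ≤ L * (δ / (2 * (L + 1))) := by gcongr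
      refine h2.trans ?_
      rw [mul_div_assoc', div_le_div_iff₀ (by positivity) (by positivity)]
      nlinarith
  have hI : Integrable (fun x => δ / 2 + {x : Phase d | P < ‖x‖}.indicator (fun _ => 2 * C) x) μ :=
    (integrable_const _).add ((integrable_const _).indicator hmeas)
  refine (norm_integral_le_of_norm_le hI (Eventually.of_forall hbound)).trans ?_
  rw [integral_add (integrable_const _) ((integrable_const _).indicator hmeas),
    integral_const, integral_indicator_const _ hmeas]
  simp only [probReal_univ, smul_eq_mul]
  have h3 : μ.real {x | P < ‖x‖} * (2 * C) ≤ δ / (2 * (2 * C + 1)) * (2 * C) := by gcongr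
  have h4 : δ / (2 * (2 * C + 1)) * (2 * C) ≤ δ / 2 := by
    rw [div_mul_eq_mul_div, div_le_div_iff₀ (by positivity) (by positivity)]
    nlinarith
  linarith

end Equicontinuity

/-! ### Convergence of the attenuated transports -/

section Convergence

variable {d : ℕ} {Φ : Space d → ℝ} {b T : ℝ}

theorem eventually_dist_truncFlow_le {E : Type*} [NormedAddCommGroup E] [NormedSpace ℝ E]
    [MeasurableSpace E] {w : ℕ → ℝ → E → E} {v : ℝ → E → E}
    (hw : ∀ n, RegularField T (w n)) (hv : RegularField T v) {R : ℝ} (hR : 0 < R)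
    (hlim : ∀ δ > 0, ∀ᶠ n in atTop, ∀ t ∈ Icc 0 T, ∀ x : E, ‖x‖ ≤ R → ‖w n t x - v t x‖ ≤ δ)
    {κ : ℝ} (hκ : 0 < κ) :
    ∀ᶠ n in atTop, ∀ x : E, ∀ t ∈ Icc 0 T,
      dist (timeFlow (truncField R (w n)) t x) (timeFlow (truncField R v) t x) ≤ κ := by
  obtain ⟨K, hK⟩ := hv.lip R
  obtain ⟨δ, hδ0, hδ⟩ : ∃ δ > 0, gronwallBound 0 (K * 2 : NNReal) δ T ≤ κ := by
    have h1 := (gronwallBound_continuous_ε 0 (K * 2 : NNReal) T).tendsto 0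
    rw [gronwallBound_ε0_δ0] at h1
    have h2 := (h1.mono_left nhdsWithin_le_nhds : Tendsto _ (𝓝[>] (0 : ℝ)) _).eventually_le_const hκ
    obtain ⟨δ, h3, h4⟩ := (h2.and self_mem_nhdsWithin).exists
    exact ⟨δ, h4, h3⟩
  filter_upwards [hlim δ hδ0] with n hn x t ht
  refine (dist_truncated_traj_le hR hK hn (hv.isTraj_truncFlow hR x)
    ((hw n).isTraj_truncFlow hR x) (δ := 0) (by simp [timeFlow_zero]) t ht).trans ?_
  exact (gronwallBound_mono le_rfl hδ0.le (NNReal.coe_nonneg _) ht.2).trans hδ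

variable {F : Type*} [NormedAddCommGroup F] [NormedSpace ℝ F]

/-- Pointwise convergence along trajectories. Where the limit trajectory exists, this is continuous
dependence. Where it blows up before time `t`, the approximating trajectories cannot be over the
support of `ψ` at time `t`, since confinement would make the limit trajectory exist up to `t`. -/
theorem tendsto_attenuated (hΦ : ContDiff ℝ 2 Φ) (hb : 0 ≤ b) (hconf : Confining Φ b T)
    {G : ℕ → ℝ → Space d → Space d} {g : ℝ → Space d → Space d}
    (hG : ∀ n, ∀ t ∈ Icc 0 T, ∀ q, ‖G n t q‖ ≤ b)
    (hGr : ∀ n, RegularField T (forceField Φ (G n)))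
    (hgr : RegularField T (forceField Φ g))
    (hlim : ∀ R, ∀ δ > 0, ∀ᶠ n in atTop, ∀ t ∈ Icc 0 T, ∀ x : Phase d, ‖x‖ ≤ R →
      ‖forceField Φ (G n) t x - forceField Φ g t x‖ ≤ δ)
    {ε : ℕ → ℝ} (hε : ∀ n, 0 ≤ ε n) (hε0 : Tendsto ε atTop (𝓝 0)) {ψ : Phase d → F}
    (hψ : Continuous ψ) {R : ℝ} (hψ0 : ∀ y, R < ‖y.snd‖ → ψ y = 0) {t : ℝ} (ht : t ∈ Icc 0 T)
    (x : Phase d) :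
    Tendsto (fun n => attenuation (ε n) (forceField Φ (G n)) t x •
        ψ (timeFlow (forceField Φ (G n)) t x)) atTop
      (𝓝 (attenuation 0 (forceField Φ g) t x • ψ (timeFlow (forceField Φ g) t x))) := by
  set v := forceField Φ g with hv
  by_cases hx : x ∈ lifeSet v t
  · obtain ⟨ρ, hρ, hball⟩ := (isTraj_timeFlow hgr.lip ht.2 hx).exists_norm_le
    have hρ1 : 0 < ρ + 1 := by positivity
    have hdist : ∀ κ > 0, ∀ᶠ n in atTop, x ∈ lifeSet (forceField Φ (G n)) t ∧
        ∀ s ∈ Icc 0 t, ‖timeFlow (forceField Φ (G n)) s x‖ ≤ ρ + 1 ∧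
        dist (timeFlow (forceField Φ (G n)) s x) (timeFlow v s x) ≤ κ := by
      intro κ hκ
      filter_upwards [eventually_dist_truncFlow_le hGr hgr hρ1 (hlim (ρ + 1))
        (lt_min hκ one_pos)] with n hn
      have heq := hgr.truncFlow_eq' hρ1 ht.2 hx fun s hs => (hball s hs).trans (by linarith)
      have h1 : ∀ s ∈ Icc 0 t,
          dist (timeFlow (truncField (ρ + 1) (forceField Φ (G n))) s x) (timeFlow v s x)
            ≤ min κ 1 := fun s hs => by
        rw [← heq s hs]; exact hn x s ⟨hs.1, hs.2.trans ht.2⟩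
      have h2 : ∀ s ∈ Icc 0 t,
          ‖timeFlow (truncField (ρ + 1) (forceField Φ (G n))) s x‖ ≤ ρ + 1 := fun s hs => by
        have h3 := (h1 s hs).trans (min_le_right _ _)
        rw [dist_eq_norm] at h3
        have h4 := norm_le_norm_add_norm_sub'
          (timeFlow (truncField (ρ + 1) (forceField Φ (G n))) s x) (timeFlow v s x)
        linarith [hball s hs]
      obtain ⟨h5, h6⟩ := (hGr n).truncFlow_eq hρ1 ht.2 h2
      refine ⟨h5, fun s hs => ?_⟩
      rw [h6 s hs]
      exact ⟨h2 s hs, (h1 s hs).trans (min_le_left _ _)⟩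
    have hflow : Tendsto (fun n => timeFlow (forceField Φ (G n)) t x) atTop
        (𝓝 (timeFlow v t x)) := by
      refine tendsto_iff_dist_tendsto_zero.2 (tendsto_order.2 ⟨fun a ha =>
        Eventually.of_forall fun n => ha.trans_le dist_nonneg, fun a ha => ?_⟩)
      filter_upwards [hdist (a / 2) (by positivity)] with n hn
      exact ((hn.2 t ⟨ht.1, le_rfl⟩).2).trans_lt (by linarith)
    have hatt1 : attenuation 0 v t x = 1 := by simp [attenuation, indicator_of_mem hx]
    have hatt : Tendsto (fun n => attenuation (ε n) (forceField Φ (G n)) t x) atTop (𝓝 1) := by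
      obtain ⟨M, hM0, hM⟩ := exists_norm_forceField_le hΦ hb T (ρ + 1)
      have hlow : Tendsto (fun n => Real.exp (-(ε n * M * t))) atTop (𝓝 1) := by
        have := ((hε0.mul_const M).mul_const t).neg
        simp only [zero_mul, neg_zero] at this
        simpa [Function.comp_def] using (Real.continuous_exp.tendsto 0).comp this
      refine tendsto_of_tendsto_of_tendsto_of_le_of_le' hlow tendsto_const_nhds ?_
        (Eventually.of_forall fun n => attenuation_le_one (hε n) _ ht.1 x)
      filter_upwards [hdist 1 one_pos] with n hn
      rw [attenuation, indicator_of_mem hn.1, Real.exp_le_exp, neg_le_neg_iff]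
      have := intervalIntegral.integral_mono_on ht.1
        ((hGr n).intervalIntegrable_speed ht hn.1 (ε n) ⟨le_rfl, ht.1⟩ ⟨ht.1, le_rfl⟩)
        (intervalIntegrable_const (c := ε n * M)) (fun s hs =>
          mul_le_mul_of_nonneg_left (hM (G n) (hG n) s ⟨hs.1, hs.2.trans ht.2⟩ _
            (hn.2 s hs).1) (hε n))
      rwa [intervalIntegral.integral_const, smul_eq_mul, sub_zero, mul_comm t] at this
    rw [hatt1]
    exact hatt.smul ((hψ.tendsto _).comp hflow)
  · rw [attenuation, indicator_of_notMem hx, zero_smul]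
    refine tendsto_const_nhds.congr' ?_
    obtain ⟨ρ, hρ, hcon⟩ := hconf ‖x‖ R
    have hρ1 : 0 < ρ + 1 := by positivity
    filter_upwards [eventually_dist_truncFlow_le hGr hgr hρ1 (hlim (ρ + 1)) one_pos]
      with n hn
    refine (attenuated_eq_zero hψ0 (fun hmem => hx ?_) (ε n)).symm
    have h1 := hcon (G n) (hG n) t ht _ (isTraj_timeFlow (hGr n).lip ht.2 hmem.1)
      (by rw [timeFlow_zero]) hmem.2
    have h2 := (hGr n).truncFlow_eq' hρ1 ht.2 hmem.1 fun s hs => (h1 s hs).trans (by linarith)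
    refine (hgr.truncFlow_eq hρ1 ht.2 fun s hs => ?_).1
    have h3 := hn x s ⟨hs.1, hs.2.trans ht.2⟩
    rw [h2 s hs, dist_comm, dist_eq_norm] at h3
    have h4 := norm_le_norm_add_norm_sub' (timeFlow (truncField (ρ + 1) v) s x)
      (timeFlow (forceField Φ (G n)) s x)
    linarith [h1 s hs]

theorem tendsto_integral_attenuatedTransport (hΦ : ContDiff ℝ 2 Φ) (hb : 0 ≤ b)
    (hconf : Confining Φ b T) (μ : Measure (Phase d)) [IsFiniteMeasure μ]
    {G : ℕ → ℝ → Space d → Space d} {g : ℝ → Space d → Space d}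
    (hG : ∀ n, ∀ t ∈ Icc 0 T, ∀ q, ‖G n t q‖ ≤ b)
    (hGr : ∀ n, RegularField T (forceField Φ (G n)))
    (hgr : RegularField T (forceField Φ g))
    (hlim : ∀ R, ∀ δ > 0, ∀ᶠ n in atTop, ∀ t ∈ Icc 0 T, ∀ x : Phase d, ‖x‖ ≤ R →
      ‖forceField Φ (G n) t x - forceField Φ g t x‖ ≤ δ)
    {ε : ℕ → ℝ} (hε : ∀ n, 0 ≤ ε n) (hε0 : Tendsto ε atTop (𝓝 0)) {ψ : Phase d → F}
    (hψ : Continuous ψ) {C : ℝ} (hψC : ∀ y, ‖ψ y‖ ≤ C)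
    {R : ℝ} (hψ0 : ∀ y, R < ‖y.snd‖ → ψ y = 0) {t : ℝ} (ht : t ∈ Icc 0 T) :
    Tendsto (fun n => ∫ y, ψ y ∂(attenuatedTransport (ε n) (forceField Φ (G n)) t μ)) atTop
      (𝓝 (∫ y, ψ y ∂(attenuatedTransport 0 (forceField Φ g) t μ))) := by
  rw [hgr.integral_attenuatedTransport 0 ht μ hψ.stronglyMeasurable]
  simp only [fun n => (hGr n).integral_attenuatedTransport (ε n) ht μ hψ.stronglyMeasurable]
  refine tendsto_integral_of_dominated_convergence (fun _ => C)
    (fun n => (integrable_attenuated (hGr n) hψ hψC (hε n) ht).aestronglyMeasurable)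
    (integrable_const _) (fun n => Eventually.of_forall fun x => ?_)
    (Eventually.of_forall fun x => tendsto_attenuated hΦ hb hconf hG hGr hgr hlim hε hε0 hψ hψ0
      ht x)
  rw [norm_smul, Real.norm_of_nonneg (attenuation_nonneg _ _ _ _)]
  calc _ ≤ 1 * C := mul_le_mul (attenuation_le_one (hε n) _ ht.1 x) (hψC _) (norm_nonneg _)
        zero_le_one
    _ = C := one_mul C

end Convergence

/-! ### The interaction force of a measure -/

section InteractionForce

variable {d : ℕ} {W Φ : Space d → ℝ}

/-- The gradient `∇(W * ν)(q) = ∫ ∇W (q - q') dν(p', q')` of the interaction potential. -/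
noncomputable def interactionForce (W : Space d → ℝ) (ν : Measure (Phase d)) (q : Space d) :
    Space d :=
  ∫ y, gradient W (q - y.snd) ∂ν

theorem gradient_contDiff {f : Space d → ℝ} (hf : ContDiff ℝ 2 f) : ContDiff ℝ 1 (gradient f) := by
  unfold gradient
  exact (LinearIsometryEquiv.contDiff _).comp (hf.fderiv_right (by norm_num))

theorem hasCompactSupport_gradient (hW : HasCompactSupport W) : HasCompactSupport (gradient W) :=
  (hW.fderiv ℝ).comp_left (g := (InnerProductSpace.toDual ℝ (Space d)).symm) (map_zero _)

theorem continuous_snd_phase : Continuous (fun y : Phase d => y.snd) :=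
  (WithLp.sndL 2 ℝ (Space d) (Space d)).continuous

theorem lipschitzWith_gradient_sub_snd {K : NNReal} (hK : LipschitzWith K (gradient W))
    (q : Space d) : LipschitzWith K (fun y : Phase d => gradient W (q - y.snd)) := by
  refine LipschitzWith.of_dist_le_mul fun x y => (hK.dist_le_mul _ _).trans ?_
  rw [dist_sub_left]
  gcongr
  exact WithLp.dist_snd_le x y

theorem integrable_gradient_sub_snd (hW : ContDiff ℝ 2 W) {b : ℝ}
    (hb : ∀ q, ‖gradient W q‖ ≤ b) (ν : Measure (Phase d)) [IsFiniteMeasure ν] (q : Space d) :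
    Integrable (fun y : Phase d => gradient W (q - y.snd)) ν := by
  refine Integrable.of_bound (C := b) ?_ (Eventually.of_forall fun y => hb _)
  exact ((continuous_gradient hW).comp
    (continuous_const.sub continuous_snd_phase)).aestronglyMeasurable

theorem hasGradientAt_convPotential (hW : ContDiff ℝ 2 W) {b C : ℝ}
    (hb : ∀ q, ‖gradient W q‖ ≤ b) (hC : ∀ q, ‖W q‖ ≤ C) (ν : Measure (Phase d))
    [IsFiniteMeasure ν] (q : Space d) :
    HasGradientAt (convPotential W ν) (interactionForce W ν q) q := by
  have hcont : ∀ q : Space d, Continuous fun y : Phase d => W (q - y.snd) := fun q =>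
    hW.continuous.comp (continuous_const.sub continuous_snd_phase)
  have hfd : ∀ z, fderiv ℝ W z = InnerProductSpace.toDual ℝ (Space d) (gradient W z) := fun z => by
    simp [gradient]
  have h := hasFDerivAt_integral_of_dominated_of_fderiv_le (μ := ν) (𝕜 := ℝ)
    (F := fun q (y : Phase d) => W (q - y.snd))
    (F' := fun q (y : Phase d) => fderiv ℝ W (q - y.snd)) (x₀ := q) (s := univ)
    (bound := fun _ => b) univ_mem
    (Eventually.of_forall fun q => (hcont q).aestronglyMeasurable)
    (Integrable.of_bound (hcont q).aestronglyMeasurable C (Eventually.of_forall fun y => hC _))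
    (((hW.continuous_fderiv (by norm_num)).comp
      (continuous_const.sub continuous_snd_phase)).aestronglyMeasurable)
    (Eventually.of_forall fun y z _ => by
      rw [hfd, LinearIsometryEquiv.norm_map]; exact hb _)
    (integrable_const _)
    (Eventually.of_forall fun y z _ => by
      have h1 : HasFDerivAt W (fderiv ℝ W (z - y.snd)) (z - y.snd) :=
        (hW.differentiable (by norm_num) _).hasFDerivAt
      exact h1.comp z ((hasFDerivAt_id z).sub_const y.snd))
  rw [hasGradientAt_iff_hasFDerivAt]
  refine h.congr_fderiv ?_
  simp only [hfd, interactionForce]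
  exact ((InnerProductSpace.toDual ℝ (Space d)).toContinuousLinearEquiv.toContinuousLinearMap
    |>.integral_comp_comm (integrable_gradient_sub_snd hW hb ν q))

theorem hamVelocity_eq_forceField (hW : ContDiff ℝ 2 W) (hWs : HasCompactSupport W)
    (hΦ : ContDiff ℝ 2 Φ) {b : ℝ} (hb : ∀ q, ‖gradient W q‖ ≤ b) (ν : Measure (Phase d))
    [IsFiniteMeasure ν] {g : ℝ → Space d → Space d} {t : ℝ} (hg : g t = interactionForce W ν) :
    hamVelocity W Φ ν = forceField Φ g t := by
  obtain ⟨C, hC⟩ := hWs.exists_bound_of_continuous hW.continuous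
  ext1 x
  have h1 := hasGradientAt_convPotential hW hb hC ν x.snd
  have h2 : HasGradientAt Φ (gradient Φ x.snd) x.snd :=
    (hΦ.differentiable (by norm_num) _).hasGradientAt
  have h3 : gradient (fun q => convPotential W ν q + Φ q) x.snd
      = interactionForce W ν x.snd + gradient Φ x.snd := by
    refine HasGradientAt.gradient ?_
    rw [hasGradientAt_iff_hasFDerivAt] at h1 h2 ⊢
    rw [map_add]
    exact h1.add h2
  rw [hamVelocity, gradHam, symplJ, h3, forceField, hg]
  rfl

theorem norm_interactionForce_le {b : ℝ} (hb : ∀ q, ‖gradient W q‖ ≤ b)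
    {ν : Measure (Phase d)} (hν : ν univ ≤ 1) (q : Space d) : ‖interactionForce W ν q‖ ≤ b := by
  have hb0 : 0 ≤ b := (norm_nonneg _).trans (hb 0)
  have : IsFiniteMeasure ν := ⟨hν.trans_lt ENNReal.one_lt_top⟩
  refine (norm_integral_le_of_norm_le_const (Eventually.of_forall fun y => hb _)).trans ?_
  have h1 : ν.real univ ≤ 1 := ENNReal.toReal_le_of_le_ofReal zero_le_one (by simpa using hν)
  nlinarith

theorem lipschitzWith_interactionForce (hW : ContDiff ℝ 2 W) {b : ℝ}
    (hb : ∀ q, ‖gradient W q‖ ≤ b) {K : NNReal} (hK : LipschitzWith K (gradient W))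
    {ν : Measure (Phase d)} (hν : ν univ ≤ 1) : LipschitzWith K (interactionForce W ν) := by
  have : IsFiniteMeasure ν := ⟨hν.trans_lt ENNReal.one_lt_top⟩
  refine LipschitzWith.of_dist_le_mul fun q q' => ?_
  rw [dist_eq_norm, interactionForce, interactionForce,
    ← integral_sub (integrable_gradient_sub_snd hW hb ν q) (integrable_gradient_sub_snd hW hb ν q')]
  refine (norm_integral_le_of_norm_le_const (C := K * dist q q')
    (Eventually.of_forall fun y => ?_)).trans ?_
  · rw [← dist_eq_norm]
    refine (hK.dist_le_mul _ _).trans ?_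
    rw [dist_sub_right]
  · have h1 : ν.real univ ≤ 1 := ENNReal.toReal_le_of_le_ofReal zero_le_one (by simpa using hν)
    have h2 : (0 : ℝ) ≤ K * dist q q' := by positivity
    nlinarith

/-! ### Regularity of force fields -/

theorem exists_lipschitzOnWith_forceField (hΦ : ContDiff ℝ 2 Φ) (K : NNReal) (R : ℝ) :
    ∃ K' : NNReal, ∀ (g : ℝ → Space d → Space d) (t : ℝ), LipschitzWith K (g t) →
      LipschitzOnWith K' (forceField Φ g t) (Metric.closedBall 0 R) := by
  obtain ⟨L, hL⟩ : ∃ L : NNReal, LipschitzOnWith L (gradient Φ) (Metric.closedBall 0 R) := by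
    obtain ⟨C, hC⟩ := (isCompact_closedBall (0 : Space d) R).exists_bound_of_continuousOn
      ((gradient_contDiff hΦ).continuous_fderiv (by norm_num)).continuousOn
    refine ⟨Real.toNNReal C, (convex_closedBall 0 R).lipschitzOnWith_of_nnnorm_fderiv_le
      (fun x _ => (gradient_contDiff hΦ).differentiable (by norm_num) x) fun x hx => ?_⟩
    exact NNReal.le_toNNReal_of_coe_le (hC x hx)
  refine ⟨K + L + 1, fun g t hg => LipschitzOnWith.of_dist_le_mul fun x hx y hy => ?_⟩
  have hx' : x.snd ∈ Metric.closedBall (0 : Space d) R := by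
    simpa using (WithLp.norm_snd_le _ _).trans (by simpa using hx)
  have hy' : y.snd ∈ Metric.closedBall (0 : Space d) R := by
    simpa using (WithLp.norm_snd_le _ _).trans (by simpa using hy)
  have h1 := norm_phase_le (forceField Φ g t x - forceField Φ g t y)
  rw [dist_eq_norm]
  refine h1.trans ?_
  simp only [forceField, WithLp.sub_fst, WithLp.sub_snd, WithLp.toLp_fst, WithLp.toLp_snd]
  have h2 := hg.dist_le_mul x.snd y.snd
  have h3 := hL.dist_le_mul _ hx' _ hy'
  have h4 := WithLp.dist_snd_le x y
  have h5 := WithLp.dist_fst_le x y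
  rw [← dist_eq_norm, ← dist_eq_norm, dist_neg_neg]
  have h6 := dist_add_add_le (g t x.snd) (gradient Φ x.snd) (g t y.snd) (gradient Φ y.snd)
  have h7 : (K : ℝ) * dist x.snd y.snd ≤ K * dist x y := by gcongr
  have h8 : (L : ℝ) * dist x.snd y.snd ≤ L * dist x y := by gcongr
  push_cast
  linarith

theorem continuous_forceField (hΦ : ContDiff ℝ 2 Φ) {g : ℝ → Space d → Space d}
    (hg : Continuous (Function.uncurry g)) : Continuous (Function.uncurry (forceField Φ g)) := by
  have h1 : Continuous fun p : ℝ × Phase d => g p.1 p.2.snd :=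
    hg.comp (continuous_fst.prodMk (continuous_snd_phase.comp continuous_snd))
  have h2 : Continuous fun p : ℝ × Phase d => gradient Φ p.2.snd :=
    (continuous_gradient hΦ).comp (continuous_snd_phase.comp continuous_snd)
  have h3 : Continuous fun p : ℝ × Phase d => p.2.fst :=
    (WithLp.fstL 2 ℝ (Space d) (Space d)).continuous.comp continuous_snd
  exact (WithLp.prod_continuous_toLp 2 (Space d) (Space d)).comp ((h1.add h2).neg.prodMk h3)

theorem regularField_of_continuous (hΦ : ContDiff ℝ 2 Φ) {T b : ℝ} (hT : 0 ≤ T) (hb0 : 0 ≤ b)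
    {K : NNReal} {g : ℝ → Space d → Space d} (hg : Continuous (Function.uncurry g))
    (hb : ∀ t ∈ Icc 0 T, ∀ q, ‖g t q‖ ≤ b) (hK : ∀ t ∈ Icc 0 T, LipschitzWith K (g t)) :
    RegularField T (forceField Φ g) := by
  have hc := continuous_forceField hΦ hg
  refine RegularField.of_continuous hT hc.measurable (fun R => ?_) (fun R => ?_)
    (fun x => (hc.comp (continuous_id.prodMk continuous_const)).continuousOn)
  · obtain ⟨K', hK'⟩ := exists_lipschitzOnWith_forceField hΦ K R
    exact ⟨K', fun t ht => hK' g t (hK t ht)⟩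
  · obtain ⟨M, hM0, hM⟩ := exists_norm_forceField_le hΦ hb0 T R
    exact ⟨M, hM0, fun t ht x hx => hM g hb t ht x hx⟩

end InteractionForce

/-! ### Compactness of equicontinuous families -/

section Compactness

/-- Sequential form of the Arzelà–Ascoli theorem for the compact-open topology. -/
theorem exists_subseq_tendsto_of_equicontinuous {X V : Type*} [TopologicalSpace X]
    [WeaklyLocallyCompactSpace X] [SigmaCompactSpace X] [NormedAddCommGroup V] [ProperSpace V]
    (F : ℕ → C(X, V)) (hF : Equicontinuous fun n => (F n : X → V)) {b : ℝ}
    (hb : ∀ n x, ‖F n x‖ ≤ b) :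
    ∃ (φ : ℕ → ℕ) (G : C(X, V)), StrictMono φ ∧ Tendsto (F ∘ φ) atTop (𝓝 G) := by
  let A : Set (X → V) := closure (range fun n => (F n : X → V))
  have hA : A.Equicontinuous := (equicontinuous_iff_range.1 hF).closure
  have hAc : IsCompact A := by
    refine (isCompact_univ_pi fun _ : X => isCompact_closedBall (0 : V) b).of_isClosed_subset
      isClosed_closure (closure_minimal ?_ ?_)
    · rintro _ ⟨n, rfl⟩ x -
      simpa using hb n x
    · exact isClosed_set_pi fun _ _ => Metric.isClosed_closedBall
  let S : Set C(X, V) := {f | (f : X → V) ∈ A}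
  have himg : ContinuousMap.toFun '' S = A := by
    ext f
    constructor
    · rintro ⟨h, hh, rfl⟩; exact hh
    · exact fun hf => ⟨⟨f, hA.continuous ⟨f, hf⟩⟩, hf, rfl⟩
  have hS : IsCompact S := ArzelaAscoli.isCompact_of_equicontinuous S (himg ▸ hAc)
    (hA.comp fun f : S => (⟨f.1, f.2⟩ : A))
  obtain ⟨G, -, φ, hφ, hG⟩ := hS.tendsto_subseq (x := F)
    fun n => (subset_closure ⟨n, rfl⟩ : (F n : X → V) ∈ A)
  exact ⟨φ, G, hφ, hG⟩

/-- Functions of time and space that are bounded, Lipschitz in space and equicontinuous in time have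
a locally uniformly convergent subsequence. -/
theorem exists_subseq_unif_tendsto {V : Type*} [NormedAddCommGroup V]
    [ProperSpace V] {T b : ℝ} (hT : 0 ≤ T) {K : NNReal} (f : ℕ → ℝ → V → V)
    (hb : ∀ n, ∀ t ∈ Icc 0 T, ∀ q, ‖f n t q‖ ≤ b)
    (hK : ∀ n, ∀ t ∈ Icc 0 T, LipschitzWith K (f n t))
    (heq : ∀ R, ∀ δ > 0, ∃ η > 0, ∀ n, ∀ s ∈ Icc 0 T, ∀ t ∈ Icc 0 T, |t - s| ≤ η →
      ∀ q, ‖q‖ ≤ R → ‖f n t q - f n s q‖ ≤ δ) :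
    ∃ (φ : ℕ → ℕ) (g : ℝ → V → V), StrictMono φ ∧ Continuous (Function.uncurry g) ∧
      ∀ R, ∀ δ > 0, ∀ᶠ n in atTop, ∀ t ∈ Icc 0 T, ∀ q, ‖q‖ ≤ R →
        ‖f (φ n) t q - g t q‖ ≤ δ := by
  have hequi : Equicontinuous (fun n (p : Icc 0 T × V) => f n p.1 p.2) := by
    intro p
    rw [Metric.equicontinuousAt_iff]
    intro δ hδ
    obtain ⟨η, hη, h⟩ := heq ‖p.2‖ (δ / 2) (by positivity)
    refine ⟨min η (δ / (2 * (K + 1))), by positivity, fun x hx n => ?_⟩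
    have h1 : dist x.1 p.1 < η :=
      (le_max_left _ _ : dist x.1 p.1 ≤ dist x p).trans_lt (hx.trans_le (min_le_left _ _))
    have h2 : dist x.2 p.2 < δ / (2 * (K + 1)) :=
      (le_max_right _ _ : dist x.2 p.2 ≤ dist x p).trans_lt (hx.trans_le (min_le_right _ _))
    have h3 := h n p.1 p.1.2 x.1 x.1.2 h1.le p.2 le_rfl
    have h4 := (hK n x.1 x.1.2).dist_le_mul x.2 p.2
    rw [← dist_eq_norm] at h3
    have h5 : K * dist x.2 p.2 < δ / 2 := by
      rw [lt_div_iff₀ (by positivity)] at h2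
      have : (0 : ℝ) ≤ K := K.2
      rcases eq_or_ne (dist x.2 p.2) 0 with h0 | h0
      · rw [h0, mul_zero]; positivity
      · have : 0 < dist x.2 p.2 := lt_of_le_of_ne dist_nonneg (Ne.symm h0)
        nlinarith
    calc dist (f n p.1 p.2) (f n x.1 x.2)
        ≤ dist (f n x.1 p.2) (f n p.1 p.2) + dist (f n x.1 x.2) (f n x.1 p.2) := by
          rw [dist_comm (f n p.1 p.2), dist_comm (f n x.1 p.2), add_comm,
            dist_comm (f n p.1 p.2)]
          exact dist_triangle _ _ _
      _ < δ := by linarith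
  obtain ⟨φ, G, hφ, hG⟩ := exists_subseq_tendsto_of_equicontinuous
    (fun n => ⟨_, hequi.continuous n⟩) hequi (b := b) (fun n p => hb n p.1 p.1.2 p.2)
  refine ⟨φ, fun t q => G (projIcc 0 T hT t, q), hφ, ?_, fun R δ hδ => ?_⟩
  · exact G.continuous.comp ((continuous_projIcc.comp continuous_fst).prodMk continuous_snd)
  · have h1 := ContinuousMap.tendsto_iff_forall_isCompact_tendstoUniformlyOn.1 hG
      (univ ×ˢ Metric.closedBall 0 R) (isCompact_univ.prod (isCompact_closedBall _ _))
    filter_upwards [Metric.tendstoUniformlyOn_iff.1 h1 δ hδ] with n hn t ht q hq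
    have h2 := hn (⟨t, ht⟩, q) ⟨mem_univ _, by simpa using hq⟩
    rw [dist_comm, dist_eq_norm] at h2
    simpa [projIcc_of_mem hT ht] using h2.le

end Compactness

/-! ### The time-discretized measures as attenuated transports -/

section Discretization

variable {d : ℕ} {W Φ : Space d → ℝ} {b : ℝ} {K : NNReal}

/-- Regularity and quantitative bounds on the interaction potential `W` and the external
potential `Φ`. -/
structure AdmissiblePotentials (W Φ : Space d → ℝ) (b : ℝ) (K : NNReal) : Prop where
  contDiff_W : ContDiff ℝ 2 W
  compact_W : HasCompactSupport W
  contDiff_Φ : ContDiff ℝ 2 Φ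
  norm_le : ∀ q, ‖gradient W q‖ ≤ b
  lip : LipschitzWith K (gradient W)

namespace AdmissiblePotentials

theorem nonneg (h : AdmissiblePotentials W Φ b K) : 0 ≤ b := (norm_nonneg _).trans (h.norm_le 0)

theorem regularField_const (h : AdmissiblePotentials W Φ b K) {ν : Measure (Phase d)}
    (hν : ν univ ≤ 1) {s : ℝ} (hs : 0 ≤ s) :
    RegularField s (forceField Φ (fun _ => interactionForce W ν)) :=
  have hl := lipschitzWith_interactionForce h.contDiff_W h.norm_le h.lip hν
  regularField_of_continuous h.contDiff_Φ hs h.nonneg (hl.continuous.comp continuous_snd)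
    (fun _ _ => norm_interactionForce_le h.norm_le hν) (fun _ _ => hl)

theorem hamVelocity_eq (h : AdmissiblePotentials W Φ b K) {ν : Measure (Phase d)}
    (hν : ν univ ≤ 1) {g : ℝ → Space d → Space d} {t : ℝ} (hg : g t = interactionForce W ν) :
    hamVelocity W Φ ν = forceField Φ g t :=
  have : IsFiniteMeasure ν := ⟨hν.trans_lt ENNReal.one_lt_top⟩
  hamVelocity_eq_forceField h.contDiff_W h.compact_W h.contDiff_Φ h.norm_le ν hg

theorem deficientEvolution_eq (h : AdmissiblePotentials W Φ b K) {ν : Measure (Phase d)}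
    (hν : ν univ ≤ 1) {s : ℝ} (hs : 0 ≤ s) (ε : ℝ) (μ : Measure (Phase d)) :
    deficientEvolution ε (hamVelocity W Φ ν) s μ
      = attenuatedTransport ε (forceField Φ (fun _ => interactionForce W ν)) s μ := by
  have e : forceField Φ (fun _ => interactionForce W ν) = fun _ : ℝ => hamVelocity W Φ ν :=
    funext fun t => (h.hamVelocity_eq hν (t := t) rfl).symm
  rw [e]
  exact deficientEvolution_eq_attenuatedTransport hs (e ▸ h.regularField_const hν hs) ε μ

theorem gridMeasure_univ_le (h : AdmissiblePotentials W Φ b K) {μ₀ : Measure (Phase d)}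
    (hμ₀ : μ₀ univ ≤ 1) {ε s : ℝ} (hε : 0 ≤ ε) (hs : 0 ≤ s) (k : ℕ) :
    gridMeasure W Φ μ₀ ε s k univ ≤ 1 := by
  induction k with
  | zero => exact hμ₀
  | succ k ih =>
    rw [gridMeasure, h.deficientEvolution_eq ih hs]
    exact (attenuatedTransport_univ_le hε hs _).trans ih

end AdmissiblePotentials

/-- The piecewise constant in time force generated by the measures at the grid points. -/
noncomputable def stepForce (W Φ : Space d → ℝ) (μ₀ : Measure (Phase d)) (T ε : ℝ) (n : ℕ) (t : ℝ) :
    Space d → Space d :=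
  interactionForce W (gridMeasure W Φ μ₀ ε (T / n) ⌊t / (T / n)⌋₊)

namespace AdmissiblePotentials

variable {μ₀ : Measure (Phase d)} {T ε : ℝ} {n : ℕ}

theorem norm_stepForce_le (h : AdmissiblePotentials W Φ b K) (hμ₀ : μ₀ univ ≤ 1) (hT : 0 < T)
    (hε : 0 ≤ ε) (t : ℝ) (q : Space d) : ‖stepForce W Φ μ₀ T ε n t q‖ ≤ b :=
  norm_interactionForce_le h.norm_le (h.gridMeasure_univ_le hμ₀ hε (by positivity) _) q

theorem regularField_stepForce (h : AdmissiblePotentials W Φ b K) (hμ₀ : μ₀ univ ≤ 1) (hT : 0 < T)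
    (hn : 0 < n) (hε : 0 ≤ ε) : RegularField T (forceField Φ (stepForce W Φ μ₀ T ε n)) := by
  have hmass : ∀ k, gridMeasure W Φ μ₀ ε (T / n) k univ ≤ 1 := fun k =>
    h.gridMeasure_univ_le hμ₀ hε (by positivity) k
  refine RegularField.of_steps (V := fun k => forceField Φ
    (fun _ => interactionForce W (gridMeasure W Φ μ₀ ε (T / n) k)) 0) hT hn (fun R => ?_)
    (fun R => ?_) fun k => ?_
  · obtain ⟨K', hK'⟩ := exists_lipschitzOnWith_forceField h.contDiff_Φ K R
    exact ⟨K', fun k => hK' _ _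
      (lipschitzWith_interactionForce h.contDiff_W h.norm_le h.lip (hmass k))⟩
  · obtain ⟨M, hM0, hM⟩ := exists_norm_forceField_le h.contDiff_Φ h.nonneg 0 R
    exact ⟨M, hM0, fun k => hM _ (fun _ _ => norm_interactionForce_le h.norm_le (hmass k)) 0
      (by simp)⟩
  · have hl := lipschitzWith_interactionForce h.contDiff_W h.norm_le h.lip (hmass k)
    have hc : Continuous (Function.uncurry fun _ : ℝ =>
        interactionForce W (gridMeasure W Φ μ₀ ε (T / n) k)) := hl.continuous.comp continuous_snd
    have hv := continuous_forceField h.contDiff_Φ hc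
    exact hv.comp (f := fun x : Phase d => ((0 : ℝ), x)) (by fun_prop)

/-- One step of the scheme extends the transport along the piecewise constant field. -/
theorem deficientEvolution_step (h : AdmissiblePotentials W Φ b K) (hμ₀ : μ₀ univ ≤ 1) (hT : 0 < T)
    (hn : 0 < n) (hε : 0 ≤ ε) {k : ℕ} {s : ℝ} (hs : s ∈ Icc 0 (T / n))
    (hkT : k * (T / n) + s ≤ T)
    (hk : gridMeasure W Φ μ₀ ε (T / n) k
      = attenuatedTransport ε (forceField Φ (stepForce W Φ μ₀ T ε n)) (k * (T / n)) μ₀) :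
    deficientEvolution ε (hamVelocity W Φ (gridMeasure W Φ μ₀ ε (T / n) k)) s
        (gridMeasure W Φ μ₀ ε (T / n) k)
      = attenuatedTransport ε (forceField Φ (stepForce W Φ μ₀ T ε n)) (k * (T / n) + s) μ₀ := by
  have hτ : 0 < T / n := by have : (0 : ℝ) < n := Nat.cast_pos.2 hn; positivity
  have hmass := h.gridMeasure_univ_le hμ₀ hε hτ.le k
  rw [h.deficientEvolution_eq hmass hs.1]
  have key := attenuatedTransport_add (h.regularField_stepForce hμ₀ hT hn hε)
    (h.regularField_const hmass hs.1) (by positivity) hs.1 hkT (fun r hr => by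
      ext1 x
      simp only [forceField, stepForce]
      rw [floor_grid_add hτ k ⟨hr.1, hr.2.trans_le hs.2⟩]) ε μ₀
  rwa [← hk] at key

theorem gridMeasure_eq (h : AdmissiblePotentials W Φ b K) (hμ₀ : μ₀ univ ≤ 1) (hT : 0 < T)
    (hn : 0 < n) (hε : 0 ≤ ε) (k : ℕ) (hk : k ≤ n) :
    gridMeasure W Φ μ₀ ε (T / n) k
      = attenuatedTransport ε (forceField Φ (stepForce W Φ μ₀ T ε n)) (k * (T / n)) μ₀ := by
  have hn' : (0 : ℝ) < n := Nat.cast_pos.2 hn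
  induction k with
  | zero =>
    rw [gridMeasure, Nat.cast_zero, zero_mul, attenuatedTransport_zero_time]
  | succ k ih =>
    have h1 : ((k : ℝ) + 1) * (T / n) ≤ T := by
      rw [mul_div_assoc', div_le_iff₀ hn', mul_comm]
      exact mul_le_mul_of_nonneg_left (by exact_mod_cast hk) hT.le
    rw [gridMeasure, h.deficientEvolution_step hμ₀ hT hn hε ⟨by positivity, le_rfl⟩
      (by linarith) (ih (by omega)), Nat.cast_succ, add_mul, one_mul]

theorem discretized_eq (h : AdmissiblePotentials W Φ b K) (hμ₀ : μ₀ univ ≤ 1) (hT : 0 < T)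
    (hn : 0 < n) (hε : 0 ≤ ε) {t : ℝ} (ht : t ∈ Icc 0 T) :
    discretized W Φ μ₀ T ε n t
      = attenuatedTransport ε (forceField Φ (stepForce W Φ μ₀ T ε n)) t μ₀ := by
  obtain ⟨h1, h2⟩ := grid_floor_mem hT hn ht
  have := h.deficientEvolution_step hμ₀ hT hn hε h2 (by linarith [ht.2])
    (h.gridMeasure_eq hμ₀ hT hn hε _ h1)
  rw [add_sub_cancel] at this
  exact this

theorem stepForce_eq (h : AdmissiblePotentials W Φ b K) (hμ₀ : μ₀ univ ≤ 1) (hT : 0 < T)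
    (hn : 0 < n) (hε : 0 ≤ ε) {t : ℝ} (ht : t ∈ Icc 0 T) :
    stepForce W Φ μ₀ T ε n t = interactionForce W (attenuatedTransport ε
      (forceField Φ (stepForce W Φ μ₀ T ε n)) (⌊t / (T / n)⌋₊ * (T / n)) μ₀) := by
  rw [← h.gridMeasure_eq hμ₀ hT hn hε _ (grid_floor_mem hT hn ht).1, stepForce]

/-- The observable `y ↦ ∇W (q - y.snd)`, for `q` in a ball, is supported over a fixed ball of
positions. -/
theorem exists_radius_gradient_sub_eq_zero (h : AdmissiblePotentials W Φ b K) :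
    ∃ r : ℝ, ∀ R : ℝ, ∀ q : Space d, ‖q‖ ≤ R → ∀ y : Phase d, r + R < ‖y.snd‖ →
      gradient W (q - y.snd) = 0 := by
  obtain ⟨r, hr⟩ := (hasCompactSupport_gradient h.compact_W).isCompact.isBounded.exists_norm_le
  refine ⟨r, fun R q hq y hy => ?_⟩
  by_contra hne
  have h1 := hr _ (subset_tsupport _ hne)
  have h2 := norm_sub_norm_le y.snd q
  rw [norm_sub_rev] at h2
  linarith

/-- The interaction forces generated by attenuated transports are equicontinuous in time, uniformly
in the force that drives the transport. -/
theorem exists_equicontinuous_force (h : AdmissiblePotentials W Φ b K) (hconf : Confining Φ b T)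
    (μ : Measure (Phase d)) [IsProbabilityMeasure μ] (R : ℝ) {δ : ℝ} (hδ : 0 < δ) :
    ∃ η : ℝ, 0 < η ∧ ∀ g : ℝ → Space d → Space d,
      (∀ t ∈ Icc 0 T, ∀ q, ‖g t q‖ ≤ b) → RegularField T (forceField Φ g) →
      ∀ ε ∈ Icc (0 : ℝ) 1, ∀ s ∈ Icc 0 T, ∀ t ∈ Icc 0 T, |t - s| ≤ η → ∀ q, ‖q‖ ≤ R →
      ‖interactionForce W (attenuatedTransport ε (forceField Φ g) t μ) q
        - interactionForce W (attenuatedTransport ε (forceField Φ g) s μ) q‖ ≤ δ := by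
  obtain ⟨r, hr⟩ := h.exists_radius_gradient_sub_eq_zero
  obtain ⟨η, hη, H⟩ := exists_equicontinuous_integral (F := Space d) h.contDiff_Φ h.nonneg hconf μ
    (r + R) K h.nonneg hδ
  exact ⟨η, hη, fun g hg hv ε hε s hs t ht hst q hq =>
    H g hg hv _ (lipschitzWith_gradient_sub_snd h.lip q) (fun y => h.norm_le _) (hr R q hq) ε hε
      s hs t ht hst⟩

end AdmissiblePotentials

end Discretization

/-! ### The weak formulation -/

section WeakFormulation

variable {d : ℕ} {W Φ : Space d → ℝ} {b T : ℝ}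

theorem deriv_add_inner_gradient_eq_fderiv {E : Type*} [NormedAddCommGroup E]
    [InnerProductSpace ℝ E] [CompleteSpace E] {φ : ℝ × E → ℝ} (hφ : Differentiable ℝ φ)
    (t : ℝ) (x w : E) :
    deriv (fun s => φ (s, x)) t + inner ℝ w (gradient (fun y => φ (t, y)) x)
      = fderiv ℝ φ (t, x) (1, w) := by
  have h := (hφ (t, x)).hasFDerivAt
  have h1 : HasDerivAt (fun s => φ (s, x)) (fderiv ℝ φ (t, x) (1, 0)) t :=
    h.comp_hasDerivAt t ((hasDerivAt_id t).prodMk (hasDerivAt_const t x))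
  have h2 : HasFDerivAt (fun y => φ (t, y))
      ((fderiv ℝ φ (t, x)).comp ((0 : E →L[ℝ] ℝ).prod (ContinuousLinearMap.id ℝ E))) x :=
    h.comp x ((hasFDerivAt_const t x).prodMk (hasFDerivAt_id x))
  rw [h1.deriv, gradient, h2.fderiv, real_inner_comm, InnerProductSpace.toDual_symm_apply]
  change fderiv ℝ φ (t, x) (1, 0) + fderiv ℝ φ (t, x) (0, w) = _
  rw [← map_add]
  simp

theorem transportIntegrand_eq_fderiv {φ : ℝ × Phase d → ℝ} (hφ : Differentiable ℝ φ)
    (v : Phase d → Phase d) (t : ℝ) (x : Phase d) :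
    transportIntegrand v φ t x = fderiv ℝ φ (t, x) (1, v x) :=
  deriv_add_inner_gradient_eq_fderiv hφ t x (v x)

theorem attenuation_zero_rate {E : Type*} [NormedAddCommGroup E] [NormedSpace ℝ E]
    (v : ℝ → E → E) (t : ℝ) : attenuation 0 v t = (lifeSet v t).indicator fun _ => 1 := by
  ext x; simp [attenuation]

/-- The test function along one trajectory, set to zero after blow-up, is differentiable from the
right and continuous, also at the blow-up time. As it vanishes at the times `0` and `T`, its
derivative has zero integral. -/
theorem integral_fderiv_along_trajectory (hΦ : ContDiff ℝ 2 Φ) (hb : 0 ≤ b)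
    (hconf : Confining Φ b T) (hT : 0 ≤ T) {g : ℝ → Space d → Space d}
    (hg : ∀ t ∈ Icc 0 T, ∀ q, ‖g t q‖ ≤ b) (hgr : RegularField T (forceField Φ g))
    {φ : ℝ × Phase d → ℝ} (hφ : ContDiff ℝ ∞ φ) (hφc : HasCompactSupport φ)
    (hφT : tsupport φ ⊆ Ioo 0 T ×ˢ univ) (x : Phase d)
    (hint : IntervalIntegrable (fun t => attenuation 0 (forceField Φ g) t x *
      fderiv ℝ φ (t, timeFlow (forceField Φ g) t x)
        (1, forceField Φ g t (timeFlow (forceField Φ g) t x))) volume 0 T) :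
    ∫ t in (0 : ℝ)..T, attenuation 0 (forceField Φ g) t x *
      fderiv ℝ φ (t, timeFlow (forceField Φ g) t x)
        (1, forceField Φ g t (timeFlow (forceField Φ g) t x)) = 0 := by
  set v := forceField Φ g with hv
  obtain ⟨L, hL⟩ := hφ.lipschitzWith_of_hasCompactSupport hφc (by simp)
  obtain ⟨R, hR⟩ := hφc.isCompact.isBounded.exists_norm_le
  have hφ0 : ∀ t y, R < ‖WithLp.snd y‖ → φ (t, y) = 0 := by
    intro t y hy
    by_contra hne
    have h1 := hR (t, y) (subset_tsupport _ hne)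
    have h2 := (norm_snd_le (t, y)).trans h1
    exact absurd ((WithLp.norm_snd_le _ y).trans h2) (not_le.2 hy)
  let f : ℝ → ℝ := fun t => attenuation 0 v t x * φ (t, timeFlow v t x)
  have hf1 : ∀ t, x ∈ lifeSet v t → f t = φ (t, timeFlow v t x) := fun t ht => by
    simp only [f, attenuation_zero_rate, indicator_of_mem ht, one_mul]
  have hf0 : ∀ t, x ∉ lifeSet v t → f t = 0 := fun t ht => by
    simp only [f, attenuation_zero_rate, indicator_of_notMem ht, zero_mul]
  have hends : ∀ t, t ∉ Ioo 0 T → f t = 0 := fun t ht => by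
    have : φ (t, timeFlow v t x) = 0 := by
      by_contra hne
      exact ht (hφT (subset_tsupport _ hne)).1
    simp only [f, this, mul_zero]
  obtain ⟨ρ, η, hρ, hη, hclose⟩ := exists_confined_of_close_times hΦ hb hconf ‖x‖ R
  obtain ⟨M, hM0, hM⟩ := exists_norm_forceField_le hΦ hb T ρ
  -- at close times, `f` vanishes at both or the trajectory is confined and has bounded speed
  have hlip : ∀ s t, 0 ≤ s → s ≤ t → t ≤ T → t - s ≤ η →
      |f t - f s| ≤ L * (1 + M) * (t - s) := by
    intro s t hs hst htT hts
    by_cases hor : (x ∈ lifeSet v s ∧ ‖(timeFlow v s x).snd‖ ≤ R) ∨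
        (x ∈ lifeSet v t ∧ ‖(timeFlow v t x).snd‖ ≤ R)
    · obtain ⟨hmem, hball⟩ := hclose g hg hgr x le_rfl s t hs hst htT hts hor
      have h1 : ‖timeFlow v t x - timeFlow v s x‖ ≤ M * (t - s) :=
        (isTraj_timeFlow hgr.lip htT hmem).norm_sub_le hs hst le_rfl fun r hr =>
          hM g hg r ⟨hs.trans hr.1, hr.2.le.trans htT⟩ _ (hball r ⟨hs.trans hr.1, hr.2.le⟩)
      rw [hf1 t hmem, hf1 s (lifeSet_anti v hst hmem), ← Real.dist_eq]
      refine (hL.dist_le_mul _ _).trans ?_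
      rw [mul_assoc]
      refine mul_le_mul_of_nonneg_left ?_ L.2
      rw [Prod.dist_eq, Real.dist_eq, dist_eq_norm, abs_of_nonneg (sub_nonneg.2 hst)]
      have h0 := sub_nonneg.2 hst
      have h2 : 0 ≤ M * (t - s) := by positivity
      exact max_le (by nlinarith) (by nlinarith)
    · rw [not_or] at hor
      have hz : ∀ τ, ¬ (x ∈ lifeSet v τ ∧ ‖(timeFlow v τ x).snd‖ ≤ R) → f τ = 0 := by
        intro τ hτ
        by_cases hx : x ∈ lifeSet v τ
        · rw [hf1 τ hx]
          exact hφ0 _ _ (not_le.1 fun h' => hτ ⟨hx, h'⟩)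
        · exact hf0 τ hx
      rw [hz t hor.2, hz s hor.1, sub_zero, abs_zero]
      have h0 := sub_nonneg.2 hst
      positivity
  have hcont : ContinuousOn f (Icc 0 T) := by
    intro s hs
    refine Metric.continuousWithinAt_iff.2 fun δ hδ => ?_
    refine ⟨min η (δ / (L * (1 + M) + 1)), by positivity, fun t ht hts => ?_⟩
    have h1 : |t - s| ≤ η := by
      rw [← Real.dist_eq]; exact hts.le.trans (min_le_left _ _)
    have h2 : |t - s| < δ / (L * (1 + M) + 1) := by
      rw [← Real.dist_eq]; exact hts.trans_le (min_le_right _ _)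
    have h3 : |f t - f s| ≤ L * (1 + M) * |t - s| := by
      rcases le_total s t with h | h
      · rw [abs_of_nonneg (sub_nonneg.2 h)] at h1 ⊢
        exact hlip s t hs.1 h ht.2 h1
      · rw [abs_sub_comm t s, abs_of_nonneg (sub_nonneg.2 h)] at h1 ⊢
        rw [abs_sub_comm]
        exact hlip t s ht.1 h hs.2 h1
    rw [lt_div_iff₀ (by positivity)] at h2
    rw [Real.dist_eq]
    have h4 : (0 : ℝ) ≤ L * (1 + M) := by positivity
    nlinarith [abs_nonneg (t - s)]
  have hderiv : ∀ t ∈ Ioo 0 T, HasDerivWithinAt f (attenuation 0 v t x *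
      fderiv ℝ φ (t, timeFlow v t x) (1, v t (timeFlow v t x))) (Ioi t) t := by
    intro t ht
    by_cases hx : x ∈ lifeSet v t
    · obtain ⟨_, η', _, hη', hclose'⟩ :=
        exists_confined_of_close_times hΦ hb hconf ‖x‖ ‖(timeFlow v t x).snd‖
      have htt : t < min (t + η') T := lt_min (by linarith) ht.2
      obtain ⟨hmem, -⟩ := hclose' g hg hgr x le_rfl t (min (t + η') T) ht.1.le htt.le
        (min_le_right _ _) (by linarith [min_le_left (t + η') T]) (Or.inl ⟨hx, le_rfl⟩)
      have h1 := (isTraj_timeFlow hgr.lip (min_le_right _ _) hmem).2 t ⟨ht.1.le, htt⟩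
      have h2 := (hφ.differentiable (by simp) (t, timeFlow v t x)).hasFDerivAt.comp_hasDerivWithinAt
        t ((hasDerivWithinAt_id t (Ici t)).prodMk h1)
      have h3 : attenuation 0 v t x = 1 := by
        rw [attenuation_zero_rate, indicator_of_mem hx]
      rw [h3, one_mul]
      refine (h2.congr_of_eventuallyEq ?_ (hf1 t hx)).Ioi_of_Ici
      filter_upwards [Icc_mem_nhdsGE_of_mem (⟨le_rfl, htt⟩ : t ∈ Ico t _)] with r hr
      exact hf1 r (lifeSet_anti v hr.2 hmem)
    · have h3 : attenuation 0 v t x = 0 := by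
        rw [attenuation_zero_rate, indicator_of_notMem hx]
      rw [h3, zero_mul]
      refine (hasDerivWithinAt_const t (Ioi t) (0 : ℝ)).congr (fun r hr => ?_) (hf0 t hx)
      exact hf0 r fun h' => hx (lifeSet_anti v (le_of_lt hr) h')
  rw [intervalIntegral.integral_eq_sub_of_hasDeriv_right (f := f)
    (by rwa [uIcc_of_le hT]) (by rwa [min_eq_left hT, max_eq_right hT]) hint,
    hends T (by simp), hends 0 (by simp), sub_zero]

/-- If the driving force is the one generated by the transported measures, these solve the
Hamiltonian ODE. -/
theorem solvesHamiltonianODE_of_selfConsistent (hΦ : ContDiff ℝ 2 Φ) (hb : 0 ≤ b)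
    (hconf : Confining Φ b T) (hT : 0 ≤ T) {g : ℝ → Space d → Space d}
    (hgc : Continuous (Function.uncurry g))
    (hg : ∀ t ∈ Icc 0 T, ∀ q, ‖g t q‖ ≤ b) (hgr : RegularField T (forceField Φ g))
    (μ₀ : Measure (Phase d)) [IsFiniteMeasure μ₀]
    (hself : ∀ t ∈ Icc 0 T,
      hamVelocity W Φ (attenuatedTransport 0 (forceField Φ g) t μ₀) = forceField Φ g t) :
    SolvesHamiltonianODE W Φ T (fun t => attenuatedTransport 0 (forceField Φ g) t μ₀) := by
  intro φ hφ hφc hφT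
  set v := forceField Φ g with hv
  have hvc : Continuous (Function.uncurry v) := continuous_forceField hΦ hgc
  let θ : ℝ × Phase d → ℝ := fun p => fderiv ℝ φ p (1, v p.1 p.2)
  have hθc : Continuous θ :=
    (hφ.continuous_fderiv (by simp)).clm_apply (continuous_const.prodMk hvc)
  have hθs : HasCompactSupport θ := by
    refine (hφc.fderiv ℝ).mono' ?_
    refine (fun p hp => subset_tsupport _ fun h0 => hp ?_)
    simp only [θ, h0, zero_apply]
  obtain ⟨C, hC⟩ := hθs.exists_bound_of_continuous hθc
  have hC0 : 0 ≤ C := (norm_nonneg _).trans (hC 0)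
  have hti : ∀ t ∈ Icc 0 T,
      transportIntegrand (hamVelocity W Φ (attenuatedTransport 0 v t μ₀)) φ t
        = fun x => θ (t, x) := fun t ht => by
    ext x
    rw [hself t ht, transportIntegrand_eq_fderiv (hφ.differentiable (by simp))]
  have hθt : ∀ t, Continuous fun x => θ (t, x) := fun t =>
    hθc.comp (continuous_const.prodMk continuous_id)
  have hinner : ∀ t ∈ Icc 0 T,
      ∫ x, transportIntegrand (hamVelocity W Φ (attenuatedTransport 0 v t μ₀)) φ t x
        ∂(attenuatedTransport 0 v t μ₀)
      = ∫ x, attenuation 0 v t x * θ (t, timeFlow v t x) ∂μ₀ := fun t ht => by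
    rw [hti t ht, hgr.integral_attenuatedTransport 0 ht μ₀ (hθt t).stronglyMeasurable]
    rfl
  -- a version of the integrand that is measurable on the whole of `ℝ × Phase d`
  let H : ℝ × Phase d → ℝ := {p : ℝ × Phase d | p.2 ∈ lifeSet v (clampTime T p.1)}.indicator
    fun p => θ (p.1, timeFlow v (clampTime T p.1) p.2)
  have hHm : Measurable H := Measurable.indicator
    (hθc.measurable.comp (measurable_fst.prodMk (hgr.measurable_timeFlow_prod hT)))
    (hgr.measurableSet_lifeSet_prod hT)
  have hHb : ∀ p, ‖H p‖ ≤ C := fun p => by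
    refine (norm_indicator_le_norm_self _ _).trans (hC _)
  have hHe : ∀ t ∈ Icc 0 T, ∀ x, H (t, x) = attenuation 0 v t x * θ (t, timeFlow v t x) := by
    intro t ht x
    by_cases hx : x ∈ lifeSet v t
    · have : (t, x) ∈ {p : ℝ × Phase d | p.2 ∈ lifeSet v (clampTime T p.1)} := by
        show x ∈ lifeSet v (clampTime T t)
        rwa [clampTime_of_mem ht]
      simp only [H, indicator_of_mem this, attenuation_zero_rate, indicator_of_mem hx, one_mul,
        clampTime_of_mem ht]
    · have : (t, x) ∉ {p : ℝ × Phase d | p.2 ∈ lifeSet v (clampTime T p.1)} := by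
        show x ∉ lifeSet v (clampTime T t)
        rwa [clampTime_of_mem ht]
      simp only [H, indicator_of_notMem this, attenuation_zero_rate, indicator_of_notMem hx,
        zero_mul]
  have hHI : Integrable H ((volume.restrict (Ioc 0 T)).prod μ₀) :=
    Integrable.of_bound hHm.aestronglyMeasurable C (Eventually.of_forall hHb)
  have hcongr : EqOn (fun t => ∫ x, H (t, x) ∂μ₀) (fun t =>
      ∫ x, transportIntegrand (hamVelocity W Φ (attenuatedTransport 0 v t μ₀)) φ t x
        ∂(attenuatedTransport 0 v t μ₀)) (Ioc 0 T) := fun t ht => by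
    have ht' : t ∈ Icc 0 T := ⟨ht.1.le, ht.2⟩
    simp only [hinner t ht', hHe t ht']
  refine ⟨fun t ht => ?_, ?_, ?_⟩
  · have ht' : t ∈ Icc 0 T := ⟨ht.1.le, ht.2.le⟩
    have hfin : IsFiniteMeasure (attenuatedTransport 0 v t μ₀) :=
      ⟨(attenuatedTransport_univ_le le_rfl ht'.1 _).trans_lt (measure_lt_top _ _)⟩
    beta_reduce
    rw [hti t ht']
    exact Integrable.of_bound (hθt t).aestronglyMeasurable C (Eventually.of_forall fun x => hC _)
  · rw [intervalIntegrable_iff_integrableOn_Ioc_of_le hT]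
    exact IntegrableOn.congr_fun hHI.integral_prod_left hcongr measurableSet_Ioc
  · rw [intervalIntegral.integral_of_le hT, ← setIntegral_congr_fun measurableSet_Ioc hcongr,
      integral_integral_swap (f := fun t x => H (t, x)) hHI]
    refine integral_eq_zero_of_ae (Eventually.of_forall fun x => ?_)
    have hHx : EqOn (fun t => H (t, x)) (fun t => attenuation 0 v t x * θ (t, timeFlow v t x))
        (Ioc 0 T) := fun t ht => hHe t ⟨ht.1.le, ht.2⟩ x
    have hI : IntervalIntegrable (fun t => attenuation 0 v t x * θ (t, timeFlow v t x))
        volume 0 T := by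
      rw [intervalIntegrable_iff_integrableOn_Ioc_of_le hT]
      refine IntegrableOn.congr_fun (f := fun t => H (t, x)) ?_ hHx measurableSet_Ioc
      exact Integrable.of_bound (hHm.comp measurable_prodMk_right).aestronglyMeasurable C
        (Eventually.of_forall fun t => hHb _)
    have h0 := integral_fderiv_along_trajectory hΦ hb hconf hT hg hgr hφ hφc hφT x hI
    rw [intervalIntegral.integral_of_le hT] at h0
    simp only [Pi.zero_apply]
    rw [setIntegral_congr_fun measurableSet_Ioc hHx]
    exact h0

end WeakFormulation

/-! ### Passage to the limit -/

section Limit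

variable {d : ℕ} {W Φ : Space d → ℝ} {b T : ℝ} {K : NNReal}

theorem forceField_sub (g g' : ℝ → Space d → Space d) (t : ℝ) (x : Phase d) :
    ‖forceField Φ g t x - forceField Φ g' t x‖ = ‖g t x.snd - g' t x.snd‖ := by
  have : forceField Φ g t x - forceField Φ g' t x
      = WithLp.toLp 2 (-(g t x.snd - g' t x.snd), (0 : Space d)) := by
    rw [forceField, forceField, ← WithLp.toLp_sub, Prod.mk_sub_mk, sub_self]
    congr 2
    abel
  rw [this, WithLp.norm_toLp_fst, norm_neg]

theorem dist_grid_floor_le (hT : 0 < T) {n : ℕ} (hn : 0 < n) {t : ℝ} (ht : t ∈ Icc 0 T) :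
    (⌊t / (T / n)⌋₊ * (T / n) : ℝ) ∈ Icc 0 T ∧ |t - ⌊t / (T / n)⌋₊ * (T / n)| ≤ T / n := by
  obtain ⟨-, h1, h2⟩ := grid_floor_mem hT hn ht
  exact ⟨⟨by positivity, by linarith [ht.2]⟩, by rwa [abs_of_nonneg h1]⟩

/-- Along a subsequence of the scheme with `ε = 1 / (m + 1)` and `m + 1` steps, the interaction
forces converge locally uniformly to a continuous force, and so do the piecewise constant ones. -/
theorem AdmissiblePotentials.exists_limit_force (h : AdmissiblePotentials W Φ b K)
    (hconf : Confining Φ b T) (hT : 0 < T) (μ₀ : Measure (Phase d)) [IsProbabilityMeasure μ₀] :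
    ∃ (m : ℕ → ℕ) (g : ℝ → Space d → Space d), StrictMono m ∧ Continuous (Function.uncurry g) ∧
      (∀ R, ∀ δ > 0, ∀ᶠ k in atTop, ∀ t ∈ Icc 0 T, ∀ q, ‖q‖ ≤ R →
        ‖interactionForce W (attenuatedTransport (1 / ((m k : ℝ) + 1))
          (forceField Φ (stepForce W Φ μ₀ T (1 / ((m k : ℝ) + 1)) (m k + 1))) t μ₀) q
            - g t q‖ ≤ δ) ∧
      (∀ R, ∀ δ > 0, ∀ᶠ k in atTop, ∀ t ∈ Icc 0 T, ∀ q, ‖q‖ ≤ R →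
        ‖stepForce W Φ μ₀ T (1 / ((m k : ℝ) + 1)) (m k + 1) t q - g t q‖ ≤ δ) := by
  have hμ₀ : μ₀ univ ≤ 1 := prob_le_one
  have hε : ∀ m : ℕ, (1 / ((m : ℝ) + 1)) ∈ Icc (0 : ℝ) 1 := fun m =>
    ⟨by positivity, by rw [div_le_one (by positivity)]; linarith [Nat.cast_nonneg (α := ℝ) m]⟩
  let G : ℕ → ℝ → Space d → Space d := fun m =>
    stepForce W Φ μ₀ T (1 / ((m : ℝ) + 1)) (m + 1)
  let f : ℕ → ℝ → Space d → Space d := fun m t =>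
    interactionForce W (attenuatedTransport (1 / ((m : ℝ) + 1)) (forceField Φ (G m)) t μ₀)
  have hGb : ∀ m : ℕ, ∀ t ∈ Icc 0 T, ∀ q, ‖G m t q‖ ≤ b := fun m t _ q =>
    h.norm_stepForce_le hμ₀ hT (hε m).1 t q
  have hGr : ∀ m : ℕ, RegularField T (forceField Φ (G m)) := fun m =>
    h.regularField_stepForce hμ₀ hT (Nat.succ_pos m : 0 < m + 1) (hε m).1
  have hmass : ∀ m : ℕ, ∀ t ∈ Icc 0 T,
      attenuatedTransport (1 / ((m : ℝ) + 1)) (forceField Φ (G m)) t μ₀ univ ≤ 1 := fun m t ht =>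
    (attenuatedTransport_univ_le (hε m).1 ht.1 _).trans hμ₀
  have hequi : ∀ R, ∀ δ > 0, ∃ η > 0, ∀ m, ∀ s ∈ Icc 0 T, ∀ t ∈ Icc 0 T, |t - s| ≤ η →
      ∀ q, ‖q‖ ≤ R → ‖f m t q - f m s q‖ ≤ δ := by
    intro R δ hδ
    obtain ⟨η, hη, H⟩ := h.exists_equicontinuous_force hconf μ₀ R hδ
    exact ⟨η, hη, fun m => H (G m) (hGb m) (hGr m) _ (hε m)⟩
  obtain ⟨m, g, hm, hg, hlim⟩ := exists_subseq_unif_tendsto hT.le (K := K) f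
    (fun n t ht q => norm_interactionForce_le h.norm_le (hmass n t ht) q)
    (fun n t ht => lipschitzWith_interactionForce h.contDiff_W h.norm_le h.lip (hmass n t ht)) hequi
  refine ⟨m, g, hm, hg, hlim, fun R δ hδ => ?_⟩
  obtain ⟨η, hη, H⟩ := hequi R (δ / 3) (by positivity)
  have hstep : ∀ᶠ k in atTop, T / ((m k + 1 : ℕ) : ℝ) ≤ η := by
    have h1 : Tendsto (fun k => T / ((m k + 1 : ℕ) : ℝ)) atTop (𝓝 0) :=
      (tendsto_const_div_atTop_nhds_zero_nat T).comp
        ((tendsto_add_atTop_nat 1).comp hm.tendsto_atTop)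
    exact h1.eventually_le_const hη
  filter_upwards [hlim R (δ / 3) (by positivity), hstep] with k hk hkη t ht q hq
  obtain ⟨h1, h2⟩ := dist_grid_floor_le hT (Nat.succ_pos _ : 0 < m k + 1) ht
  -- the piecewise constant force at time `t` is the generated force at the previous grid point
  have h3 : stepForce W Φ μ₀ T (1 / ((m k : ℝ) + 1)) (m k + 1) t q
      = f (m k) (⌊t / (T / ((m k + 1 : ℕ) : ℝ))⌋₊ * (T / ((m k + 1 : ℕ) : ℝ))) q := by
    rw [h.stepForce_eq hμ₀ hT (Nat.succ_pos _ : 0 < m k + 1) (hε (m k)).1 ht]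
  rw [h3]
  have h4 := H (m k) _ h1 t ht (h2.trans hkη) q hq
  rw [norm_sub_rev] at h4
  have h5 := norm_sub_le_norm_sub_add_norm_sub
    (f (m k) (⌊t / (T / ((m k + 1 : ℕ) : ℝ))⌋₊ * (T / ((m k + 1 : ℕ) : ℝ))) q) (f (m k) t q)
    (g t q)
  linarith [hk t ht q hq]

/-- Smooth compactly supported functions on phase space are Lipschitz, bounded observables that are
supported over a ball of positions. -/
theorem exists_bounds_of_test {φ : Phase d → ℝ} (hφ : ContDiff ℝ ∞ φ) (hφc : HasCompactSupport φ) :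
    ∃ (L : NNReal) (C R : ℝ), 0 ≤ C ∧ LipschitzWith L φ ∧ (∀ y, ‖φ y‖ ≤ C) ∧
      ∀ y, R < ‖y.snd‖ → φ y = 0 := by
  obtain ⟨L, hL⟩ := hφ.lipschitzWith_of_hasCompactSupport hφc (by simp)
  obtain ⟨C, hC⟩ := hφc.exists_bound_of_continuous hφ.continuous
  obtain ⟨R, hR⟩ := hφc.isCompact.isBounded.exists_norm_le
  refine ⟨L, C, R, (norm_nonneg _).trans (hC 0), hL, hC, fun y hy => ?_⟩
  by_contra hne
  exact absurd ((WithLp.norm_snd_le _ y).trans (hR y (subset_tsupport _ hne))) (not_le.2 hy)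

/-- The limit measures are the unattenuated transports of `μ₀` along the limit force. -/
theorem AdmissiblePotentials.exists_solution (h : AdmissiblePotentials W Φ b K)
    (hconf : Confining Φ b T) (hT : 0 < T) (μ₀ : Measure (Phase d)) [IsProbabilityMeasure μ₀] :
    ∃ (ε : ℕ → ℝ) (n : ℕ → ℕ) (μ : ℝ → Measure (Phase d)),
      (∀ k, 0 < ε k) ∧ StrictAnti ε ∧ Tendsto ε atTop (𝓝 0) ∧
      (∀ k, 0 < n k) ∧ StrictMono n ∧
      (∀ t ∈ Icc 0 T,
        DistribTendsto (fun k => discretized W Φ μ₀ T (ε k) (n k) t) (μ t)) ∧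
      μ 0 = μ₀ ∧
      DistribContinuousOn T μ ∧
      (∀ t ∈ Icc 0 T, μ t univ ≤ 1) ∧
      SolvesHamiltonianODE W Φ T μ := by
  have hμ₀ : μ₀ univ ≤ 1 := prob_le_one
  obtain ⟨m, g, hm, hgc, hlim, hlim'⟩ := h.exists_limit_force hconf hT μ₀
  set ε : ℕ → ℝ := fun k => 1 / ((m k : ℝ) + 1)
  have hε : ∀ k, 0 < ε k := fun k => by positivity
  have hε0 : Tendsto ε atTop (𝓝 0) :=
    (tendsto_one_div_add_atTop_nhds_zero_nat (𝕜 := ℝ)).comp hm.tendsto_atTop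
  let G : ℕ → ℝ → Space d → Space d := fun k => stepForce W Φ μ₀ T (ε k) (m k + 1)
  have hGb : ∀ k, ∀ t ∈ Icc 0 T, ∀ q, ‖G k t q‖ ≤ b := fun k t _ q =>
    h.norm_stepForce_le hμ₀ hT (hε k).le t q
  have hGr : ∀ k, RegularField T (forceField Φ (G k)) := fun k =>
    h.regularField_stepForce hμ₀ hT (Nat.succ_pos _ : 0 < m k + 1) (hε k).le
  have hmass : ∀ k, ∀ t ∈ Icc 0 T,
      attenuatedTransport (ε k) (forceField Φ (G k)) t μ₀ univ ≤ 1 := fun k t ht =>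
    (attenuatedTransport_univ_le (hε k).le ht.1 _).trans hμ₀
  have hptw : ∀ t ∈ Icc 0 T, ∀ q, Tendsto (fun k => interactionForce W
      (attenuatedTransport (ε k) (forceField Φ (G k)) t μ₀) q) atTop (𝓝 (g t q)) := by
    intro t ht q
    refine tendsto_iff_dist_tendsto_zero.2 (tendsto_order.2 ⟨fun a ha =>
      Eventually.of_forall fun n => ha.trans_le dist_nonneg, fun a ha => ?_⟩)
    filter_upwards [hlim ‖q‖ (a / 2) (by positivity)] with k hk
    rw [dist_eq_norm]
    exact (hk t ht q le_rfl).trans_lt (by linarith)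
  have hgb : ∀ t ∈ Icc 0 T, ∀ q, ‖g t q‖ ≤ b := fun t ht q =>
    le_of_tendsto (hptw t ht q).norm (Eventually.of_forall fun k =>
      norm_interactionForce_le h.norm_le (hmass k t ht) q)
  have hgK : ∀ t ∈ Icc 0 T, LipschitzWith K (g t) := fun t ht =>
    LipschitzWith.of_dist_le_mul fun q q' =>
      le_of_tendsto ((hptw t ht q).dist (hptw t ht q')) (Eventually.of_forall fun k =>
        (lipschitzWith_interactionForce h.contDiff_W h.norm_le h.lip (hmass k t ht)).dist_le_mul
          q q')
  have hgr : RegularField T (forceField Φ g) :=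
    regularField_of_continuous h.contDiff_Φ hT.le h.nonneg hgc hgb hgK
  have hfield : ∀ R, ∀ δ > 0, ∀ᶠ k in atTop, ∀ t ∈ Icc 0 T, ∀ x : Phase d, ‖x‖ ≤ R →
      ‖forceField Φ (G k) t x - forceField Φ g t x‖ ≤ δ := by
    intro R δ hδ
    filter_upwards [hlim' R δ hδ] with k hk t ht x hx
    rw [forceField_sub]
    exact hk t ht x.snd ((WithLp.norm_snd_le _ x).trans hx)
  let μ : ℝ → Measure (Phase d) := fun t => attenuatedTransport 0 (forceField Φ g) t μ₀
  have hμmass : ∀ t ∈ Icc 0 T, μ t univ ≤ 1 := fun t ht =>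
    (attenuatedTransport_univ_le le_rfl ht.1 _).trans hμ₀
  -- the forces tend to `g t q`, and by convergence of the measures also to `∇(W * μ_t)(q)`
  have hself : ∀ t ∈ Icc 0 T, g t = interactionForce W (μ t) := by
    intro t ht
    ext1 q
    obtain ⟨r, hr⟩ := h.exists_radius_gradient_sub_eq_zero
    exact tendsto_nhds_unique (hptw t ht q)
      (tendsto_integral_attenuatedTransport h.contDiff_Φ h.nonneg hconf μ₀ hGb hGr hgr hfield
        (fun k => (hε k).le) hε0 (lipschitzWith_gradient_sub_snd h.lip q).continuous
        (fun y => h.norm_le _) (hr ‖q‖ q le_rfl) ht)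
  refine ⟨ε, fun k => m k + 1, μ, hε, ?_, hε0, fun k => (Nat.succ_pos _ : 0 < m k + 1),
    fun i j hij => ?_,
    fun t ht φ hφ hφc => ?_, ?_, fun φ hφ hφc => ?_, hμmass, ?_⟩
  · intro i j hij
    have h1 : (m i : ℝ) < m j := Nat.cast_lt.2 (hm hij)
    exact one_div_lt_one_div_of_lt (by positivity) (by linarith)
  · exact Nat.add_lt_add_right (hm hij) 1
  · obtain ⟨L, C, R, -, hL, hC, hR⟩ := exists_bounds_of_test hφ hφc
    refine (tendsto_integral_attenuatedTransport h.contDiff_Φ h.nonneg hconf μ₀ hGb hGr hgr hfield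
      (fun k => (hε k).le) hε0 hL.continuous hC hR ht).congr fun k => ?_
    beta_reduce
    rw [h.discretized_eq hμ₀ hT (Nat.succ_pos _ : 0 < m k + 1) (hε k).le ht]
  · exact attenuatedTransport_zero_time _ _ _
  · obtain ⟨L, C, R, hC0, hL, hC, hR⟩ := exists_bounds_of_test hφ hφc
    intro s hs
    refine Metric.continuousWithinAt_iff.2 fun δ hδ => ?_
    obtain ⟨η, hη, H⟩ := exists_equicontinuous_integral (F := ℝ) h.contDiff_Φ h.nonneg hconf μ₀ R L
      hC0 (half_pos hδ)
    refine ⟨η, hη, fun t ht hts => ?_⟩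
    rw [Real.dist_eq] at hts
    rw [dist_eq_norm]
    exact (H g hgb hgr φ hL hC hR 0 (by simp) s hs t ht hts.le).trans_lt (half_lt_self hδ)
  · exact solvesHamiltonianODE_of_selfConsistent h.contDiff_Φ h.nonneg hconf hT.le hgc hgb hgr μ₀
      fun t ht => h.hamVelocity_eq (hμmass t ht) (hself t ht)

theorem exists_gradient_bound_lt {B : ℝ} (hW : ContDiff ℝ 2 W) (hWs : HasCompactSupport W)
    (hB : ∀ q, ‖gradient W q‖ < B) : ∃ b < B, ∀ q, ‖gradient W q‖ ≤ b := by
  obtain ⟨q₀, -, hmax⟩ := ((hasCompactSupport_gradient hWs).isCompact.insert 0).exists_isMaxOn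
    (insert_nonempty _ _) (continuous_gradient hW).norm.continuousOn
  refine ⟨_, hB q₀, fun q => ?_⟩
  by_cases hq : gradient W q = 0
  · rw [hq, norm_zero]; exact norm_nonneg _
  · exact hmax (mem_insert_of_mem _ (subset_tsupport _ hq))

end Limit

theorem mainTheorem3 {d : ℕ} (W Φ : Space d → ℝ)
    (hW : ContDiff ℝ 2 W) (hW_supp : HasCompactSupport W) (hW_even : ∀ q, W (-q) = W q)
    (hΦ : ContDiff ℝ 2 Φ)
    (hdyn : DynamicalHypothesis W Φ)
    (T : ℝ) (hT : 0 < T) (α₀ : ℝ) (hα₀ : 0 < α₀)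
    (μ₀ : Measure (Phase d)) (hμ₀ : μ₀ univ = 1)
    (hμ₀_exp : Integrable (fun x : Phase d => Real.exp (α₀ * ‖x‖)) μ₀) :
    ∃ (ε : ℕ → ℝ) (n : ℕ → ℕ) (μ : ℝ → Measure (Phase d)),
      (∀ k, 0 < ε k) ∧ StrictAnti ε ∧ Tendsto ε atTop (𝓝 0) ∧
      (∀ k, 0 < n k) ∧ StrictMono n ∧
      (∀ t ∈ Icc 0 T,
        DistribTendsto (fun k => discretized W Φ μ₀ T (ε k) (n k) t) (μ t)) ∧
      μ 0 = μ₀ ∧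
      DistribContinuousOn T μ ∧
      (∀ t ∈ Icc 0 T, μ t univ ≤ 1) ∧
      SolvesHamiltonianODE W Φ T μ := by
  obtain ⟨B, u, qstar, hB, hu, hΦu, -, hlim, hlt⟩ := hdyn
  obtain ⟨b, hbB, hb⟩ := exists_gradient_bound_lt hW hW_supp hB
  obtain ⟨K, hK⟩ := (gradient_contDiff hW).lipschitzWith_of_hasCompactSupport
    (hasCompactSupport_gradient hW_supp) one_ne_zero
  have h : AdmissiblePotentials W Φ b K := ⟨hW, hW_supp, hΦ, hb, hK⟩
  have : IsProbabilityMeasure μ₀ := ⟨hμ₀⟩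
  exact h.exists_solution (confining_of_barriers hΦ h.nonneg hbB hu hΦu hlim hlt) hT μ₀
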